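/- Notation. Let $K$ be an ordered field (for instance $\mathbb{R}$ or $\mathbb{Q}$), $n\ge 1$, $[n]=\{1,\dots,n\}$. For $M\in K^{n\times n}$ and $\alpha\subseteq[n]$ let $M_{\alpha\alpha}$ be the principal submatrix with rows and columns in $\alpha$, and for $x\in K^n$ let $\operatorname{psupp}(x)=\{j: x_j>0\}$. For an invertible matrix $A$, a vector $x$ and an index $i$ such that column $i$ of $A^{-1}$ has a positive entry, put $$\theta_i(A,x)=\min_{j:\,A^{-1}_{ji}>0}\frac{x_j}{A^{-1}_{ji}},\qquad \mathrm{reduce}_i(A,x)=x-\theta_i(A,x)\,A^{-1}e_i .$$ The procedure $\mathrm{RecursiveFind}(M,\alpha,x)$, for $\alpha\subseteq[n]$ and $x\in K^\alpha$ with $x>0$ and $M_{\alpha\alpha}x\le 0$, is: if $|\alpha|=1$ or $\det M_{\alpha\alpha}\le 0$, return $\alpha$. Otherwise, if $\det M_{\alpha\setminus\{i\},\alpha\setminus\{i\}}\le 0$ for some $i\in\alpha$, return $\alpha\setminus\{i\}$ for the least such $i$. Otherwise let $y^i=\mathrm{reduce}_i(M_{\alpha\alpha},x)$ for $i\in\alpha$,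 let $y=y^{i_*}$ for the least $i_*\in\alpha$ with $y^{i_*}\ne 0$, let $\beta=\operatorname{psupp}(y)$, and return $\mathrm{RecursiveFind}(M,\beta,y_\beta)$. Finally $\mathrm{FindNonpositiveMinor}(M,x)=\mathrm{RecursiveFind}(M,[n],x)$. Theorem. Let $M\in K^{n\times n}$ and $x\in K^n$ with $x_i>0$ and $(Mx)_i\le 0$ for all $i\in[n]$. 1. $\mathrm{FindNonpositiveMinor}(M,x)$ makes at most $n$ nested calls and returns a set $\beta\subseteq[n]$ with $\det(M_{\beta\beta})\le 0$. It computes at most $(1+n)+(1+(n-1))+\dots+(1+1)=n(n+3)/2=O(n^2)$ determinants. 2. In each call that is not answered directly, that is, whenever $|\alpha|\ge 2$, $x\in K^\alpha$, $x>0$, $M_{\alpha\alpha}x\le 0$, $\det M_{\alpha\alpha}>0$ and $\det M_{\alpha\setminus\{i\},\alpha\setminus\{i\}}>0$ for all $i\in\alpha$, every $y^i=\mathrm{reduce}_i(M_{\alpha\alpha},x)$ $(i\in\alpha)$ satisfies $y^i\ge 0$, $M_{\alpha\alpha}y^i\le 0$ and $\operatorname{psupp}(y^i)\subsetneq\alpha$,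 and $y^i\neq 0$ for at least one $i\in\alpha$. 3. The procedure runs in polynomial time. Implement it by a program that computes determinants and inverses by the method of Faddeev and LeVerrier ($N=I$; in round $k$ put $c=-\operatorname{tr}(BN)/k$ and replace $N$ by $BN+cI$). The determinant routine of this program returns the determinant of every square matrix over $K$, and the program returns $\mathrm{FindNonpositiveMinor}(M,x)$. There is a polynomial $p$, the same for all $K$, such that the program executes at most $p(n)$ steps (arithmetic operations, comparisons, loaded constants and bookkeeping steps). There is a polynomial $q$ such that for $K=\mathbb{Q}$ its total bit cost is at most $q(L)$, where $L$ is the sum of the bit lengths of the entries of $M$ and $x$, an operation or comparison on rational numbers (in lowest terms) of bit lengths $s$ and $t$ costs $(s+t)^2$, a loaded constant costs its bit length, and a bookkeeping step costs $1$. -/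

import Mathlib

namespace NonposMinor

/-! ## The recursive procedure, in exact mathematical form -/

section Algorithm

variable {K : Type} [Field K] [LinearOrder K]

/-- The principal submatrix `M_αα`. -/
def principal {n : ℕ} (M : Matrix (Fin n) (Fin n) K) (α : Finset (Fin n)) : Matrix α α K :=
  M.submatrix (fun a => (a : Fin n)) (fun a => (a : Fin n))

/-- The positive support of a vector. -/
def psupp {n : ℕ} (x : Fin n → K) : Finset (Fin n) :=
  Finset.univ.filter fun j => 0 < x j

/-- `θ_i(A, x)`, the minimum of `x j / A⁻¹ j i` over all `j` with `A⁻¹ j i > 0`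
(and `0` if there is no such `j`). -/
noncomputable def theta {ι : Type} [Fintype ι] [DecidableEq ι] (A : Matrix ι ι K) (x : ι → K)
    (i : ι) : K :=
  if h : (Finset.univ.filter fun j => 0 < A⁻¹ j i).Nonempty then
    (Finset.univ.filter fun j => 0 < A⁻¹ j i).inf' h (fun j => x j / A⁻¹ j i)
  else 0

/-- The reduction step `x - θ_i(A, x) A⁻¹ e_i`. -/
noncomputable def reduceStep {ι : Type} [Fintype ι] [DecidableEq ι] (A : Matrix ι ι K)
    (x : ι → K) (i : ι) : ι → K :=
  x - theta A x i • (A⁻¹).mulVec (Pi.single i 1)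

/-- The reduction step at `i ∈ α` for `M_αα` and `x_α`, extended by zero outside `α`. -/
noncomputable def reduceOn {n : ℕ} (M : Matrix (Fin n) (Fin n) K) (α : Finset (Fin n))
    (x : Fin n → K) (i : Fin n) : Fin n → K := fun j =>
  if h : i ∈ α ∧ j ∈ α then
    reduceStep (principal M α) (fun a => x a) ⟨i, h.1⟩ ⟨j, h.2⟩
  else 0

/-- The recursive procedure on `(M, α, x)`. A vector indexed by `α` is kept as a vector on `[n]`
of which only the entries in `α` are used. The first argument bounds the depth of the recursion;
the result `∅` (whose minor is `1`) stands for failure. -/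
noncomputable def recursiveFind {n : ℕ} (M : Matrix (Fin n) (Fin n) K) :
    ℕ → Finset (Fin n) → (Fin n → K) → Finset (Fin n)
  | 0, _, _ => ∅
  | t + 1, α, x =>
    if α.card = 1 ∨ (principal M α).det ≤ 0 then α
    else
      match (List.finRange n).find?
          (fun i => decide (i ∈ α ∧ (principal M (α.erase i)).det ≤ 0)) with
      | some i => α.erase i
      | none =>
        match (List.finRange n).find? (fun i => decide (i ∈ α ∧ reduceOn M α x i ≠ 0)) with
        | some i => recursiveFind M t (psupp (reduceOn M α x i)) (reduceOn M α x i)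
        | none => ∅

/-- The procedure, started on `α = [n]`, with at most `n` nested calls. -/
noncomputable def findNonpositiveMinor {n : ℕ} (M : Matrix (Fin n) (Fin n) K) (x : Fin n → K) :
    Finset (Fin n) :=
  recursiveFind M n Finset.univ x

end Algorithm

/-! ## Programs with a step count

A program has access to numbers (of type `ρ`) only through the instructions below. Programs are
written for an arbitrary `ρ`, so they can neither inspect a number nor compute with numbers
except by executing, and paying for, an instruction. -/

/-- The four arithmetic operations. -/
inductive ArithOp : Type
  | add
  | sub
  | mul
  | div

/-- The instructions; the index is the type of the answer. -/
inductive Instr (ρ : Type) : Type → Type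
  /-- load a natural number constant -/
  | lit (k : ℕ) : Instr ρ ρ
  /-- an arithmetic operation on two numbers -/
  | arith (o : ArithOp) (a b : ρ) : Instr ρ ρ
  /-- the comparison `a ≤ b` -/
  | le (a b : ρ) : Instr ρ Bool
  /-- one step of bookkeeping: an iteration of a loop, a cell of memory written, a call -/
  | tick : Instr ρ Unit
  /-- the same, on entry to the determinant routine -/
  | enterDet : Instr ρ Unit

/-- Programs that use numbers of type `ρ` and return a value of type `α`. -/
inductive Prog (ρ : Type) (α : Type) : Type 1
  | ret (a : α) : Prog ρ α
  | exec {β : Type} (i : Instr ρ β) (next : β → Prog ρ α) : Prog ρ α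

namespace Prog

variable {ρ α β : Type}

/-- Sequential composition. -/
def bind : Prog ρ α → (α → Prog ρ β) → Prog ρ β
  | ret a, f => f a
  | exec i next, f => exec i fun b => bind (next b) f

instance : Monad (Prog ρ) where
  pure := ret
  bind := bind

/-- The program that executes one instruction and returns the answer. -/
def instr (i : Instr ρ α) : Prog ρ α := exec i ret

end Prog

section Semantics

variable {K : Type} [Field K] [LinearOrder K]

/-- The answer to an instruction over the ordered field `K`. -/
def Instr.eval : {β : Type} → Instr K β → β
  | _, .lit k => (k : K)
  | _, .arith .add a b => a + b
  | _, .arith .sub a b => a - b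
  | _, .arith .mul a b => a * b
  | _, .arith .div a b => a / b
  | _, .le a b => decide (a ≤ b)
  | _, .tick => ()
  | _, .enterDet => ()

/-- The value returned by a program. -/
def Prog.run {α : Type} : Prog K α → α
  | .ret a => a
  | .exec i next => (next i.eval).run

/-- The total weight of the instructions executed by a program. -/
def Prog.cost (w : (β : Type) → Instr K β → ℕ) {α : Type} : Prog K α → ℕ
  | .ret _ => 0
  | .exec (β := β) i next => w β i + (next i.eval).cost w

/-- The number of instructions executed. -/
def Prog.steps {α : Type} (P : Prog K α) : ℕ := P.cost fun _ _ => 1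

/-- `1` on entry to the determinant routine, and `0` for every other instruction. -/
def Instr.detWeight : (β : Type) → Instr K β → ℕ
  | _, .enterDet => 1
  | _, _ => 0

/-- The number of determinants computed. -/
def Prog.dets {α : Type} (P : Prog K α) : ℕ := P.cost Instr.detWeight

end Semantics

/-- The bit length of a rational number in lowest terms (one bit is for the sign). -/
def bitLength (r : ℚ) : ℕ := r.num.natAbs.size + r.den.size + 1

/-- The bit cost of an instruction on rational numbers: an operation or comparison on operands
of bit lengths `s` and `t` costs `(s + t) ^ 2`. -/
def Instr.bitWeight : (β : Type) → Instr ℚ β → ℕ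
  | _, .lit k => k.size + 1
  | _, .arith _ a b => (bitLength a + bitLength b) ^ 2
  | _, .le a b => (bitLength a + bitLength b) ^ 2
  | _, .tick => 1
  | _, .enterDet => 1

/-- The bit cost of a program run on rational numbers. -/
def Prog.bitTime {α : Type} (P : Prog ℚ α) : ℕ := P.cost Instr.bitWeight

/-- The total bit length of a rational matrix and a rational vector. -/
def inputLength {n : ℕ} (M : Matrix (Fin n) (Fin n) ℚ) (x : Fin n → ℚ) : ℕ :=
  (∑ i, ∑ j, bitLength (M i j)) + ∑ i, bitLength (x i)

/-! ## The procedure as a program -/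

section Programs

variable {ρ β : Type}

open Prog

/-- Compute `f 0, …, f (k - 1)` in this order and store the results in a table. -/
def tabulate : (k : ℕ) → (Fin k → Prog ρ β) → Prog ρ (Fin k → β)
  | 0, _ => pure Fin.elim0
  | k + 1, f => do
    instr .tick
    let a ← f 0
    let v ← tabulate k fun i => f i.succ
    pure (Fin.cons a v)

/-- Compute the sum of `f 0, …, f (k - 1)`. -/
def sumProg : (k : ℕ) → (Fin k → Prog ρ ρ) → Prog ρ ρ
  | 0, _ => instr (.lit 0)
  | k + 1, f => do
    instr .tick
    let a ← f 0
    let s ← sumProg k fun i => f i.succ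
    instr (.arith .add a s)

/-- Run `f 0, f 1, …` until one of them returns a result. -/
def firstSome : (k : ℕ) → (Fin k → Prog ρ (Option β)) → Prog ρ (Option β)
  | 0, _ => pure none
  | k + 1, f => do
    instr .tick
    let r ← f 0
    match r with
    | some b => pure (some b)
    | none => firstSome k fun i => f i.succ

variable {n : ℕ}

/-- The `n × n` matrix with the block `M_αα` on `α` and the identity on the complement of `α`;
its determinant is that of `M_αα` and its inverse is the inverse of `M_αα`, padded likewise. -/
def padProg (M : Fin n → Fin n → ρ) (α : Finset (Fin n)) : Prog ρ (Fin n → Fin n → ρ) :=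
  tabulate n fun i => tabulate n fun j =>
    if i ∈ α ∧ j ∈ α then pure (M i j)
    else if i = j then instr (.lit 1)
    else instr (.lit 0)

/-- The identity matrix. -/
def identityProg : Prog ρ (Fin n → Fin n → ρ) :=
  tabulate n fun i => tabulate n fun j =>
    if i = j then instr (.lit 1) else instr (.lit 0)

/-- The product of two matrices. -/
def mulProg (A B : Fin n → Fin n → ρ) : Prog ρ (Fin n → Fin n → ρ) :=
  tabulate n fun i => tabulate n fun j =>
    sumProg n fun l => instr (.arith .mul (A i l) (B l j))

/-- The rounds `1, …, m` of the Faddeev–LeVerrier method for a matrix `B`: from `N = 1`, `c = 1`,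
round `k` puts `c = - tr (B N) / k` and then replaces `N` by `B N + c`. -/
def leverrier (B : Fin n → Fin n → ρ) : ℕ → Prog ρ ((Fin n → Fin n → ρ) × ρ)
  | 0 => do
    let N ← identityProg
    let c ← instr (.lit 1)
    pure (N, c)
  | m + 1 => do
    let s ← leverrier B m
    let P ← mulProg B s.1
    let t ← sumProg n fun i => pure (P i i)
    let z ← instr (.lit 0)
    let k ← instr (.lit (m + 1))
    let u ← instr (.arith .sub z t)
    let c ← instr (.arith .div u k)
    let N ← tabulate n fun i => tabulate n fun j =>
      if i = j then instr (.arith .add (P i j) c) else pure (P i j)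
    pure (N, c)

/-- The determinant of `B`, which is `(-1) ^ n c` for the number `c` of round `n`. -/
def detProg (B : Fin n → Fin n → ρ) : Prog ρ ρ := do
  instr .enterDet
  let s ← leverrier B n
  if n % 2 = 0 then pure s.2
  else do
    let z ← instr (.lit 0)
    instr (.arith .sub z s.2)

/-- Column `i` of the inverse of `B`, which is `- N / c` for the matrix `N` of round `n - 1` and
the number `c` of round `n`. -/
def invColProg (B : Fin n → Fin n → ρ) (i : Fin n) : Prog ρ (Fin n → ρ) := do
  let s ← leverrier B (n - 1)
  let r ← leverrier B n
  let z ← instr (.lit 0)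
  let d ← instr (.arith .sub z r.2)
  tabulate n fun j => instr (.arith .div (s.1 j i) d)

/-- The minimum of `x j / b j` over all `j` with `b j > 0`, if there is such a `j`. -/
def minRatioProg : (k : ℕ) → (x b : Fin k → ρ) → Prog ρ (Option ρ)
  | 0, _, _ => pure none
  | k + 1, x, b => do
    instr .tick
    let m ← minRatioProg k (fun j => x j.succ) (fun j => b j.succ)
    let z ← instr (.lit 0)
    let nonpos ← instr (.le (b 0) z)
    if nonpos then pure m
    else do
      let r ← instr (.arith .div (x 0) (b 0))
      match m with
      | none => pure (some r)
      | some s => do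
        let less ← instr (.le r s)
        if less then pure (some r) else pure (some s)

/-- The reduction step at `i ∈ α`, for a vector `x` that vanishes outside `α`. -/
def reduceProg (M : Fin n → Fin n → ρ) (α : Finset (Fin n)) (x : Fin n → ρ) (i : Fin n) :
    Prog ρ (Fin n → ρ) := do
  let B ← padProg M α
  let b ← invColProg B i
  let m ← minRatioProg n x b
  let θ ← match m with
    | some s => pure s
    | none => instr (.lit 0)
  tabulate n fun j => do
    let p ← instr (.arith .mul θ (b j))
    instr (.arith .sub (x j) p)

/-- Whether `y` has a nonzero entry. -/
def nonzeroProg (y : Fin n → ρ) : Prog ρ Bool := do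
  let r ← firstSome n fun j => do
    let z ← instr (.lit 0)
    let p ← instr (.le (y j) z)
    let q ← instr (.le z (y j))
    if p && q then pure none else pure (some ())
  pure r.isSome

/-- The positive support of `y`. -/
def psuppProg (y : Fin n → ρ) : Prog ρ (Finset (Fin n)) := do
  let v ← tabulate n fun j => do
    let z ← instr (.lit 0)
    instr (.le (y j) z)
  pure (Finset.univ.filter fun j => v j = false)

/-- `n` steps of bookkeeping, for an operation on a subset of `[n]` stored as `n` bits. -/
def scanProg (n : ℕ) : Prog ρ Unit := do
  let _ ← tabulate n fun _ => (pure () : Prog ρ Unit)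
  pure ()

/-- Whether `det M_αα ≤ 0`. -/
def minorNonposProg (M : Fin n → Fin n → ρ) (α : Finset (Fin n)) : Prog ρ Bool := do
  let B ← padProg M α
  let d ← detProg B
  let z ← instr (.lit 0)
  instr (.le d z)

/-- The recursive procedure as a program. -/
def recursiveFindProg (M : Fin n → Fin n → ρ) :
    ℕ → Finset (Fin n) → (Fin n → ρ) → Prog ρ (Finset (Fin n))
  | 0, _, _ => pure ∅
  | t + 1, α, x => do
    scanProg n
    if α.card = 1 then pure α
    else do
      let b ← minorNonposProg M α
      if b then pure α
      else do
        let r ← firstSome n fun i =>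
          if i ∈ α then do
            scanProg n
            let c ← minorNonposProg M (α.erase i)
            if c then pure (some (α.erase i)) else pure none
          else pure none
        match r with
        | some γ => pure γ
        | none => do
          let s ← firstSome n fun i =>
            if i ∈ α then do
              let y ← reduceProg M α x i
              let c ← nonzeroProg y
              if c then pure (some y) else pure none
            else pure none
          match s with
          | some y => do
            let γ ← psuppProg y
            recursiveFindProg M t γ y
          | none => pure ∅

/-- The whole procedure as a program with input `M` and `x`. -/
def findNonpositiveMinorProg (M : Fin n → Fin n → ρ) (x : Fin n → ρ) : Prog ρ (Finset (Fin n)) :=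
  recursiveFindProg M n Finset.univ x

end Programs

end NonposMinor

/-!
Put `A = M_αα`. The reduction in direction `i` satisfies `A y = A x - θ e_i` with `θ ≥ 0`, so it
keeps `A y ≤ 0`, and the choice of `θ` keeps `y ≥ 0` while a coordinate becomes zero: the minimum is
over a nonempty set, because `(A⁻¹)_ii` is the quotient of the minor of `α ∖ {i}` by `det A`, which
is positive when no minor answers the call directly. If all reductions vanished then `A x` would be
a multiple of `e_i` for two different `i`, hence zero, and so would be `x`. Thus the support shrinks
until a single index `a` remains, for which `M_aa x_a ≤ 0` with `x_a > 0`.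

The rounds of the method of Faddeev and LeVerrier compute the coefficients of the adjugate of
`X - B`: Jacobi's formula, the derivative of `det (X - B)` being the trace of this adjugate, yields
the coefficients of the characteristic polynomial.

For the bit cost, all numbers of round `m` have the common denominator `D ^ m * m!` for a common
denominator `D` of the matrix, which keeps the bit lengths of the matrix routines polynomial. A
reduction subtracts `x_i (u_j / u_i)`, where `u` is a multiple of a column of the inverse with
entries from such a box. The ratios `u_j / u_i` do not depend on `x`, so the bit length of a common
denominator of `x` grows by an amount independent of `x` in each of the at most `n` calls.
-/

namespace NonposMinor

/-! ### Programs -/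

namespace Prog

section Basics

variable {ρ α β : Type}

@[simp]
theorem bind_eq (P : Prog ρ α) (f : α → Prog ρ β) : P >>= f = P.bind f := rfl

@[simp]
theorem pure_eq (a : α) : (pure a : Prog ρ α) = ret a := rfl

theorem bind_assoc {γ : Type} (P : Prog ρ α) (f : α → Prog ρ β) (g : β → Prog ρ γ) :
    (P.bind f).bind g = P.bind fun a => (f a).bind g := by
  induction P with
  | ret a => rfl
  | exec i next ih => simp [Prog.bind, ih]

end Basics

section Semantics

variable {K : Type} [Field K] [LinearOrder K] {α β : Type}

@[simp]
theorem run_ret (a : α) : (ret a : Prog K α).run = a := rfl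

-- The parentheses keep `simp` from treating this as a definitional rewrite, which in the condition
-- of an `if` would leave the `Decidable` instance behind.
@[simp]
theorem run_instr (i : Instr K α) : (instr i).run = i.eval := (rfl)

@[simp]
theorem run_bind (P : Prog K α) (f : α → Prog K β) : (P.bind f).run = (f P.run).run := by
  induction P with
  | ret a => rfl
  | exec i _ ih => exact ih _

theorem cost_bind (w : (β : Type) → Instr K β → ℕ) (P : Prog K α) (f : α → Prog K β) :
    (P.bind f).cost w = P.cost w + (f P.run).cost w := by
  induction P with
  | ret a => simp [Prog.bind, cost, run]
  | exec i next ih => simp [Prog.bind, cost, run, ih, add_assoc]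

@[simp]
theorem steps_ret (a : α) : (ret a : Prog K α).steps = 0 := rfl

@[simp]
theorem steps_instr (i : Instr K α) : (instr i).steps = 1 := rfl

@[simp]
theorem steps_bind (P : Prog K α) (f : α → Prog K β) :
    (P.bind f).steps = P.steps + (f P.run).steps :=
  cost_bind _ P f

@[simp]
theorem dets_ret (a : α) : (ret a : Prog K α).dets = 0 := rfl

@[simp]
theorem dets_instr (i : Instr K α) : (instr i).dets = Instr.detWeight α i := rfl

@[simp]
theorem dets_bind (P : Prog K α) (f : α → Prog K β) :
    (P.bind f).dets = P.dets + (f P.run).dets :=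
  cost_bind _ P f

end Semantics

end Prog

open Prog

section Combinators

variable {K : Type} [Field K] [LinearOrder K] {β : Type}

@[simp]
theorem run_tabulate (k : ℕ) (f : Fin k → Prog K β) :
    (tabulate k f).run = fun i => (f i).run := by
  induction k with
  | zero => exact Subsingleton.elim _ _
  | succ k ih =>
    funext i
    cases i using Fin.cases <;> simp [tabulate, ih]

@[simp]
theorem steps_tabulate (k : ℕ) (f : Fin k → Prog K β) :
    (tabulate k f).steps = ∑ i, (1 + (f i).steps) := by
  induction k with
  | zero => simp [tabulate]
  | succ k ih => simp [tabulate, ih, Fin.sum_univ_succ, add_assoc]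

@[simp]
theorem dets_tabulate (k : ℕ) (f : Fin k → Prog K β) :
    (tabulate k f).dets = ∑ i, (f i).dets := by
  induction k with
  | zero => simp [tabulate]
  | succ k ih => simp [tabulate, ih, Fin.sum_univ_succ, Instr.detWeight]

@[simp]
theorem run_sumProg (k : ℕ) (f : Fin k → Prog K K) : (sumProg k f).run = ∑ i, (f i).run := by
  induction k with
  | zero => simp [sumProg, Instr.eval]
  | succ k ih => simp [sumProg, Instr.eval, ih, Fin.sum_univ_succ]

@[simp]
theorem steps_sumProg (k : ℕ) (f : Fin k → Prog K K) :
    (sumProg k f).steps = 1 + ∑ i, (2 + (f i).steps) := by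
  induction k with
  | zero => simp [sumProg]
  | succ k ih =>
    simp only [sumProg, bind_eq, steps_bind, steps_instr, ih, Fin.sum_univ_succ]
    ring

@[simp]
theorem dets_sumProg (k : ℕ) (f : Fin k → Prog K K) :
    (sumProg k f).dets = ∑ i, (f i).dets := by
  induction k with
  | zero => simp [sumProg, Instr.detWeight]
  | succ k ih => simp [sumProg, ih, Fin.sum_univ_succ, Instr.detWeight]

theorem run_firstSome (k : ℕ) (f : Fin k → Prog K (Option β)) :
    (firstSome k f).run = (List.finRange k).findSome? fun i => (f i).run := by
  induction k with
  | zero => simp [firstSome]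
  | succ k ih =>
    rw [List.finRange_succ, List.findSome?_cons]
    cases h : (f 0).run <;> simp [firstSome, h, ih, List.findSome?_map, Function.comp_def]

theorem run_firstSome_eq_find? (k : ℕ) (f : Fin k → Prog K (Option β)) (p : Fin k → Prop)
    [DecidablePred p] (g : Fin k → β) (hf : ∀ i, (f i).run = if p i then some (g i) else none) :
    (firstSome k f).run = ((List.finRange k).find? fun i => decide (p i)).map g := by
  simp only [run_firstSome, hf]
  induction List.finRange k with
  | nil => rfl
  | cons i l ih => by_cases h : p i <;> simp [h, ih]

theorem steps_firstSome_le (k : ℕ) (f : Fin k → Prog K (Option β)) :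
    (firstSome k f).steps ≤ ∑ i, (1 + (f i).steps) := by
  induction k with
  | zero => simp [firstSome]
  | succ k ih =>
    have := ih fun i => f i.succ
    simp only [firstSome, bind_eq, pure_eq, steps_bind, steps_instr, Fin.sum_univ_succ]
    cases (f 0).run <;> simp only [steps_ret] <;> omega

theorem dets_firstSome_le (k : ℕ) (f : Fin k → Prog K (Option β)) :
    (firstSome k f).dets ≤ ∑ i, (f i).dets := by
  induction k with
  | zero => simp [firstSome]
  | succ k ih =>
    have := ih fun i => f i.succ
    simp only [firstSome, bind_eq, pure_eq, dets_bind, dets_instr, Instr.detWeight,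
      Fin.sum_univ_succ]
    cases (f 0).run <;> simp only [dets_ret] <;> omega

end Combinators

section NumbersIn

variable {K : Type} [Field K] {α β : Type} {s t : Set K}

/-- All numbers that an instruction loads or operates on lie in `s`. -/
def Instr.NumbersIn (s : Set K) : {β : Type} → Instr K β → Prop
  | _, .lit k => (k : K) ∈ s
  | _, .arith _ a b => a ∈ s ∧ b ∈ s
  | _, .le a b => a ∈ s ∧ b ∈ s
  | _, .tick => True
  | _, .enterDet => True

theorem Instr.NumbersIn.mono (hst : s ⊆ t) {i : Instr K β} (hi : i.NumbersIn s) :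
    i.NumbersIn t := by
  cases i with
  | lit k => exact hst hi
  | arith o a b => exact ⟨hst hi.1, hst hi.2⟩
  | le a b => exact ⟨hst hi.1, hst hi.2⟩
  | tick => trivial
  | enterDet => trivial

variable [LinearOrder K]

/-- All numbers that a program loads or operates on when it is run lie in `s`. A bound on these
numbers turns a bound on the number of steps into a bound on the bit cost. -/
def Prog.NumbersIn (s : Set K) : Prog K α → Prop
  | .ret _ => True
  | .exec i next => i.NumbersIn s ∧ (next i.eval).NumbersIn s

namespace Prog

@[simp]
theorem numbersIn_ret (a : α) : (ret a : Prog K α).NumbersIn s := trivial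

@[simp]
theorem numbersIn_instr (i : Instr K α) : (instr i).NumbersIn s ↔ i.NumbersIn s := by
  simp [instr, Prog.NumbersIn]

@[simp]
theorem numbersIn_bind (P : Prog K α) (f : α → Prog K β) :
    (P.bind f).NumbersIn s ↔ P.NumbersIn s ∧ (f P.run).NumbersIn s := by
  induction P with
  | ret a => simp [Prog.bind, run]
  | exec i next ih => simp [Prog.bind, Prog.NumbersIn, run, ih, and_assoc]

theorem NumbersIn.mono (hst : s ⊆ t) {P : Prog K α} (hP : P.NumbersIn s) : P.NumbersIn t := by
  induction P with
  | ret a => trivial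
  | exec i next ih => exact ⟨hP.1.mono hst, ih _ hP.2⟩

end Prog

@[simp]
theorem numbersIn_tabulate (k : ℕ) (f : Fin k → Prog K β) :
    (tabulate k f).NumbersIn s ↔ ∀ i, (f i).NumbersIn s := by
  induction k with
  | zero => simp [tabulate]
  | succ k ih => simp [tabulate, ih, Fin.forall_fin_succ, Instr.NumbersIn]

theorem numbersIn_sumProg (k : ℕ) (f : Fin k → Prog K K) (hf : ∀ i, (f i).NumbersIn s)
    (hs : ∀ T : Finset (Fin k), ∑ i ∈ T, (f i).run ∈ s) : (sumProg k f).NumbersIn s := by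
  induction k with
  | zero => simpa [sumProg, Instr.NumbersIn] using hs ∅
  | succ k ih =>
    have htail (T : Finset (Fin k)) : ∑ i ∈ T, (f i.succ).run ∈ s := by
      simpa using hs (T.map (Fin.succEmb k))
    have hhead : (f 0).run ∈ s := by simpa using hs {0}
    simpa [sumProg, Instr.NumbersIn, hf, hhead, htail Finset.univ] using
      ih (fun i => f i.succ) (fun i => hf i.succ) htail

theorem numbersIn_firstSome (k : ℕ) (f : Fin k → Prog K (Option β))
    (hf : ∀ i, (f i).NumbersIn s) : (firstSome k f).NumbersIn s := by
  induction k with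
  | zero => simp [firstSome]
  | succ k ih =>
    have := ih (fun i => f i.succ) fun i => hf i.succ
    cases h : (f 0).run <;> simp [firstSome, Instr.NumbersIn, hf, h, this]

end NumbersIn

section BitTime

theorem size_natCast_le_bitLength (k : ℕ) : k.size + 1 ≤ bitLength k := by
  simp [bitLength]

theorem Instr.bitWeight_le {L : ℕ} {β : Type} (i : Instr ℚ β)
    (hi : i.NumbersIn {r | bitLength r ≤ L}) : i.bitWeight ≤ (L + L) ^ 2 + 1 := by
  cases i with
  | lit k =>
    have hk : k.size + 1 ≤ L := (size_natCast_le_bitLength k).trans hi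
    simp only [Instr.bitWeight]
    nlinarith
  | arith o a b => exact (Nat.pow_le_pow_left (add_le_add hi.1 hi.2) 2).trans (Nat.le_succ _)
  | le a b => exact (Nat.pow_le_pow_left (add_le_add hi.1 hi.2) 2).trans (Nat.le_succ _)
  | tick => exact Nat.le_add_left 1 _
  | enterDet => exact Nat.le_add_left 1 _

theorem Prog.bitTime_le {L : ℕ} {α : Type} (P : Prog ℚ α)
    (hP : P.NumbersIn {r | bitLength r ≤ L}) : P.bitTime ≤ P.steps * ((L + L) ^ 2 + 1) := by
  induction P with
  | ret a => exact Nat.zero_le _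
  | exec i next ih =>
    have h := add_le_add (i.bitWeight_le hP.1) (ih _ hP.2)
    rwa [← one_add_mul] at h

end BitTime

/-! ### The method of Faddeev and LeVerrier -/

section FaddeevLeVerrier

open Polynomial Matrix

variable {ι R : Type*} [Fintype ι] [DecidableEq ι] [CommRing R]

theorem derivative_det (A : Matrix ι ι R[X]) :
    derivative A.det = (adjugate A * A.map derivative).trace := by
  have hdiag (i : ι) : (adjugate A * A.map derivative) i i =
      ∑ σ : Equiv.Perm ι, Equiv.Perm.sign σ •
        ((∏ j ∈ Finset.univ.erase i, A (σ j) j) * derivative (A (σ i) i)) := by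
    change (adjugate A *ᵥ (A.map derivative).col i) i = _
    rw [← cramer_eq_adjugate_mulVec, cramer_apply, det_apply]
    refine Finset.sum_congr rfl fun σ _ => congrArg _ ?_
    rw [← Finset.prod_erase_mul _ _ (Finset.mem_univ i)]
    congr 1
    · refine Finset.prod_congr rfl fun j hj => ?_
      rw [updateCol_ne (Finset.ne_of_mem_erase hj)]
    · simp
  simp only [Matrix.trace, diag_apply, hdiag]
  rw [det_apply, derivative_sum, Finset.sum_comm]
  refine Finset.sum_congr rfl fun σ _ => ?_
  rw [← Finset.smul_sum, ← derivative_prod_finset]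
  simp [Units.smul_def]

theorem derivative_charpoly (B : Matrix ι ι R) :
    derivative B.charpoly = (adjugate (charmatrix B)).trace := by
  have h : (charmatrix B).map derivative = 1 := by
    ext i j
    rcases eq_or_ne i j with rfl | hij
    · simp
    · simp [hij]
  rw [Matrix.charpoly, derivative_det, h, mul_one]

/-- The coefficient of `X ^ k` in `X * adjugate (X - B)`. For `k = n, n - 1, …` these are the
matrices of the Faddeev–LeVerrier method for an `n × n` matrix `B`. -/
noncomputable def adjugateCoeff (B : Matrix ι ι R) (k : ℕ) : Matrix ι ι R :=
  (X * matPolyEquiv (adjugate (charmatrix B))).coeff k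

theorem adjugateCoeff_zero (B : Matrix ι ι R) : adjugateCoeff B 0 = 0 := by
  simp [adjugateCoeff]

theorem adjugateCoeff_eq_mul_add (B : Matrix ι ι R) (k : ℕ) :
    adjugateCoeff B k = B * adjugateCoeff B (k + 1) + scalar ι (B.charpoly.coeff k) := by
  have h : charmatrix B * adjugate (charmatrix B) = B.charpoly • 1 := mul_adjugate _
  apply_fun fun A => (matPolyEquiv A).coeff k at h
  simp only [map_mul, matPolyEquiv_charmatrix, matPolyEquiv_smul_one, sub_mul, coeff_sub,
    coeff_C_mul, coeff_map] at h
  rw [← coeff_X_mul (matPolyEquiv _) k] at h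
  exact sub_eq_iff_eq_add'.mp h

theorem trace_adjugateCoeff (B : Matrix ι ι R) (k : ℕ) :
    (adjugateCoeff B k).trace = k * B.charpoly.coeff k := by
  cases k with
  | zero => simp [adjugateCoeff_zero]
  | succ k =>
    have h := coeff_derivative B.charpoly k
    rw [derivative_charpoly] at h
    rw [mul_comm, Nat.cast_succ, ← h]
    simp [adjugateCoeff, Matrix.trace, finsetSum_coeff, matPolyEquiv_coeff_apply]

theorem adjugateCoeff_of_card_lt (B : Matrix ι ι R) {k : ℕ} (hk : Fintype.card ι < k) :
    adjugateCoeff B k = 0 := by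
  nontriviality R
  obtain ⟨m, hm⟩ : ∃ m, ∀ l, m ≤ l → adjugateCoeff B l = 0 :=
    ⟨_, fun l hl => coeff_eq_zero_of_natDegree_lt (Nat.lt_of_succ_le hl)⟩
  rcases le_total m k with hmk | hkm
  · exact hm k hmk
  induction hkm using Nat.decreasingInduction with
  | self => exact hm m le_rfl
  | of_succ l _ ih =>
    rw [adjugateCoeff_eq_mul_add, ih (hk.trans l.lt_succ_self),
      coeff_eq_zero_of_natDegree_lt ((charpoly_natDegree_eq_dim B).trans_lt hk)]
    simp

theorem charpoly_coeff_card (B : Matrix ι ι R) : B.charpoly.coeff (Fintype.card ι) = 1 := by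
  nontriviality R
  simpa [charpoly_natDegree_eq_dim] using B.charpoly_monic.coeff_natDegree

theorem adjugateCoeff_card (B : Matrix ι ι R) : adjugateCoeff B (Fintype.card ι) = 1 := by
  rw [adjugateCoeff_eq_mul_add, adjugateCoeff_of_card_lt B (Nat.lt_succ_self _),
    charpoly_coeff_card]
  simp

theorem inv_eq_smul_adjugateCoeff {K : Type*} [Field K] (B : Matrix ι ι K) (hB : B.det ≠ 0) :
    B⁻¹ = (-B.charpoly.coeff 0)⁻¹ • adjugateCoeff B 1 := by
  have hc : B.charpoly.coeff 0 ≠ 0 := by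
    rintro h
    simp [det_eq_sign_charpoly_coeff, h] at hB
  have hmul : B * adjugateCoeff B 1 = -scalar ι (B.charpoly.coeff 0) := by
    rw [← add_eq_zero_iff_eq_neg, ← adjugateCoeff_eq_mul_add, adjugateCoeff_zero]
  refine inv_eq_right_inv ?_
  rw [Matrix.mul_smul, hmul]
  ext a b
  by_cases hab : a = b <;> simp [hab, hc, one_apply]

end FaddeevLeVerrier

section Rounds

variable {K : Type} [Field K] [LinearOrder K] {n : ℕ}

theorem run_identityProg :
    (identityProg (ρ := K) (n := n)).run = (1 : Matrix (Fin n) (Fin n) K) := by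
  funext i j
  by_cases h : i = j <;> simp [identityProg, Instr.eval, h, Matrix.one_apply]

theorem run_mulProg (A B : Matrix (Fin n) (Fin n) K) :
    (mulProg A B).run = (A * B : Matrix (Fin n) (Fin n) K) := by
  funext i j
  simp [mulProg, Instr.eval, Matrix.mul_apply]

/-- The matrix `N` after round `m` of the Faddeev–LeVerrier method. -/
def leverrierMatrix (B : Matrix (Fin n) (Fin n) K) (m : ℕ) : Matrix (Fin n) (Fin n) K :=
  (leverrier B m).run.1

/-- The number `c` after round `m` of the Faddeev–LeVerrier method. -/
def leverrierScalar (B : Matrix (Fin n) (Fin n) K) (m : ℕ) : K :=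
  (leverrier B m).run.2

variable (B : Matrix (Fin n) (Fin n) K)

theorem run_leverrier (m : ℕ) :
    (leverrier B m).run = (leverrierMatrix B m, leverrierScalar B m) := rfl

theorem leverrierMatrix_zero : leverrierMatrix B 0 = 1 := by
  simp [leverrierMatrix, leverrier, run_identityProg]

theorem leverrierScalar_zero : leverrierScalar B 0 = 1 := by
  simp [leverrierScalar, leverrier, Instr.eval]

theorem run_mulProg_leverrier (m : ℕ) :
    (mulProg B (leverrier B m).run.1).run = B * leverrierMatrix B m :=
  run_mulProg B _

theorem leverrierScalar_succ (m : ℕ) :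
    leverrierScalar B (m + 1) = -(B * leverrierMatrix B m).trace / (m + 1 : ℕ) := by
  simp [leverrierScalar, leverrier, run_mulProg_leverrier, Instr.eval, Matrix.trace]

theorem leverrierMatrix_succ (m : ℕ) :
    leverrierMatrix B (m + 1) =
      B * leverrierMatrix B m + Matrix.scalar (Fin n) (leverrierScalar B (m + 1)) := by
  rw [leverrierScalar_succ, leverrierMatrix]
  ext i j
  rcases eq_or_ne i j with rfl | hij
  · simp [leverrier, run_mulProg_leverrier, Instr.eval, Matrix.trace]
  · simp [leverrier, run_mulProg_leverrier, hij]

variable [CharZero K]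

theorem leverrierMatrix_and_scalar_eq {m : ℕ} (hm : m ≤ n) :
    leverrierMatrix B m = adjugateCoeff B (n - m) ∧
      leverrierScalar B m = B.charpoly.coeff (n - m) := by
  induction m with
  | zero =>
    have hN := adjugateCoeff_card B
    have hc := charpoly_coeff_card B
    rw [Fintype.card_fin] at hN hc
    exact ⟨by rw [leverrierMatrix_zero, Nat.sub_zero, hN],
      by rw [leverrierScalar_zero, Nat.sub_zero, hc]⟩
  | succ m ih =>
    obtain ⟨k, rfl⟩ := Nat.exists_eq_add_of_le' hm
    have hN : leverrierMatrix B m = adjugateCoeff B (k + 1) := by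
      rw [(ih (by omega)).1]
      congr 1
      omega
    rw [Nat.add_sub_cancel]
    have hrec := adjugateCoeff_eq_mul_add B k
    have hc : leverrierScalar B (m + 1) = B.charpoly.coeff k := by
      have htrace := trace_adjugateCoeff B k
      rw [hrec, Matrix.trace_add, ← hN, Matrix.scalar_apply, Matrix.trace_diagonal,
        Finset.sum_const, Finset.card_fin, nsmul_eq_mul, Nat.cast_add] at htrace
      rw [leverrierScalar_succ, div_eq_iff (Nat.cast_ne_zero.mpr m.succ_ne_zero)]
      linear_combination -htrace
    exact ⟨by rw [leverrierMatrix_succ, hc, hN, ← hrec], hc⟩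

theorem leverrierMatrix_eq_adjugateCoeff {m : ℕ} (hm : m ≤ n) :
    leverrierMatrix B m = adjugateCoeff B (n - m) :=
  (leverrierMatrix_and_scalar_eq B hm).1

theorem leverrierScalar_self : leverrierScalar B n = B.charpoly.coeff 0 := by
  simpa using (leverrierMatrix_and_scalar_eq B le_rfl).2

theorem run_detProg : (detProg B).run = B.det := by
  rw [Matrix.det_eq_sign_charpoly_coeff, Fintype.card_fin, ← leverrierScalar_self]
  rcases Nat.even_or_odd n with hn | hn
  · simp [detProg, run_leverrier, Nat.even_iff.mp hn, hn.neg_one_pow]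
  · simp [detProg, run_leverrier, Nat.odd_iff.mp hn, hn.neg_one_pow, Instr.eval]

theorem run_invColProg (hB : B.det ≠ 0) (i : Fin n) :
    (invColProg B i).run = fun j => B⁻¹ j i := by
  have hN : leverrierMatrix B (n - 1) = adjugateCoeff B 1 := by
    rw [leverrierMatrix_eq_adjugateCoeff B (Nat.sub_le n 1), Nat.sub_sub_self i.pos]
  funext j
  simp [invColProg, run_leverrier, hN, leverrierScalar_self, Instr.eval,
    inv_eq_smul_adjugateCoeff B hB, div_eq_inv_mul]

end Rounds

/-! ### Reductions -/

section Padding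

variable {K : Type} [Field K] {n : ℕ}

/-- The `n × n` matrix with the block `M_αα` on `α` and the identity on the complement of `α`. -/
def padded (M : Matrix (Fin n) (Fin n) K) (α : Finset (Fin n)) : Matrix (Fin n) (Fin n) K :=
  fun i j => if i ∈ α ∧ j ∈ α then M i j else if i = j then 1 else 0

theorem run_padProg [LinearOrder K] (M : Matrix (Fin n) (Fin n) K) (α : Finset (Fin n)) :
    (padProg M α).run = padded M α := by
  funext i j
  simp only [padProg, run_tabulate, padded]
  split_ifs <;> simp [Instr.eval]

theorem padded_eq_submatrix_fromBlocks (M : Matrix (Fin n) (Fin n) K) (α : Finset (Fin n)) :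
    padded M α = (Matrix.fromBlocks (principal M α) 0 0 1).submatrix
      (Equiv.sumCompl (· ∈ α)).symm (Equiv.sumCompl (· ∈ α)).symm := by
  ext i j
  by_cases hi : i ∈ α <;> by_cases hj : j ∈ α
  · simp [padded, principal, hi, hj]
  · simp [padded, hi, hj, ne_of_mem_of_not_mem hi hj]
  · simp [padded, hi, hj, (ne_of_mem_of_not_mem hj hi).symm]
  · simp [padded, hi, hj, Matrix.one_apply]

theorem det_padded (M : Matrix (Fin n) (Fin n) K) (α : Finset (Fin n)) :
    (padded M α).det = (principal M α).det := by
  rw [padded_eq_submatrix_fromBlocks, Matrix.det_submatrix_equiv_self,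
    Matrix.det_fromBlocks_zero₂₁, Matrix.det_one, mul_one]

theorem det_padded_ne_zero {M : Matrix (Fin n) (Fin n) K} {α : Finset (Fin n)}
    (hdet : (principal M α).det ≠ 0) : (padded M α).det ≠ 0 := by
  rwa [det_padded]

theorem inv_padded (M : Matrix (Fin n) (Fin n) K) {α : Finset (Fin n)}
    (hdet : (principal M α).det ≠ 0) (i : α) (j : Fin n) :
    (padded M α)⁻¹ j i = if h : j ∈ α then (principal M α)⁻¹ ⟨j, h⟩ i else 0 := by
  have hunit : IsUnit (principal M α) :=
    (Matrix.isUnit_iff_isUnit_det _).mpr (isUnit_iff_ne_zero.mpr hdet)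
  rw [padded_eq_submatrix_fromBlocks, Matrix.inv_submatrix_equiv,
    Matrix.inv_fromBlocks_zero₂₁_of_isUnit_iff _ _ _ (iff_of_true hunit isUnit_one)]
  by_cases hj : j ∈ α <;> simp [hj]

theorem adjugate_padded (M : Matrix (Fin n) (Fin n) K) (α : Finset (Fin n)) (i : Fin n) :
    (padded M α).adjugate i i = (principal M (α.erase i)).det := by
  have hrow : (padded M α).updateRow i (Pi.single i 1) = Matrix.of
      ((α.erase i).piecewise (padded M α).row (1 : Matrix (Fin n) (Fin n) K).row) := by
    ext k j
    rcases eq_or_ne k i with rfl | hki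
    · simp [Finset.piecewise, Matrix.row, Matrix.one_apply, Pi.single_apply, eq_comm]
    · by_cases hk : k ∈ α <;>
        simp [hki, hk, padded, Finset.piecewise, Matrix.row, Matrix.one_apply]
  have hblock : ((padded M α).submatrix (↑) (↑) : Matrix (α.erase i : Finset (Fin n)) _ K) =
      principal M (α.erase i) := by
    ext k j
    simp [padded, principal, Finset.mem_of_mem_erase k.2, Finset.mem_of_mem_erase j.2]
  rw [Matrix.adjugate_apply, hrow, Matrix.det_piecewise_one_eq_submatrix_det, hblock]

theorem padded_mulVec (M : Matrix (Fin n) (Fin n) K) {α : Finset (Fin n)} {x : Fin n → K}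
    (hx : ∀ j ∉ α, x j = 0) {i : Fin n} (hi : i ∈ α) :
    (padded M α).mulVec x i = M.mulVec x i := by
  rw [Matrix.mulVec, dotProduct, Matrix.mulVec, dotProduct]
  refine Finset.sum_congr rfl fun j _ => ?_
  by_cases hj : j ∈ α <;> simp [padded, hi, hj, hx]

end Padding

section Theta

variable {K : Type} [Field K] [LinearOrder K]

/-- The set of all `x j / b j` with `b j > 0`; its minimum, for `b` the column `i` of `A⁻¹`, is
`θ_i(A, x)`. -/
def positiveRatios {ι : Type*} (x b : ι → K) : Set K :=
  {r | ∃ j, 0 < b j ∧ x j / b j = r}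

variable {ι κ : Type} [Fintype ι] [DecidableEq ι] [Fintype κ] [DecidableEq κ]
  {A : Matrix ι ι K} {x : ι → K} {i : ι}

theorem isLeast_theta (h : (positiveRatios x fun j => A⁻¹ j i).Nonempty) :
    IsLeast (positiveRatios x fun j => A⁻¹ j i) (theta A x i) := by
  obtain ⟨_, k, hk, -⟩ := h
  have hne : (Finset.univ.filter fun j => 0 < A⁻¹ j i).Nonempty := ⟨k, by simpa using hk⟩
  rw [theta, dif_pos hne]
  constructor
  · obtain ⟨j, hj, hmin⟩ := Finset.exists_mem_eq_inf' hne fun j => x j / A⁻¹ j i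
    exact ⟨j, (Finset.mem_filter.mp hj).2, hmin.symm⟩
  · rintro r ⟨j, hj, rfl⟩
    exact Finset.inf'_le (fun j => x j / A⁻¹ j i) (by simpa using hj)

theorem theta_eq_zero (h : (positiveRatios x fun j => A⁻¹ j i) = ∅) : theta A x i = 0 := by
  refine dif_neg ?_
  rintro ⟨j, hj⟩
  exact Set.eq_empty_iff_forall_notMem.mp h _ ⟨j, (Finset.mem_filter.mp hj).2, rfl⟩

theorem theta_congr {B : Matrix κ κ K} {y : κ → K} {k : κ}
    (h : (positiveRatios x fun j => A⁻¹ j i) = positiveRatios y fun j => B⁻¹ j k) :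
    theta A x i = theta B y k := by
  rcases (positiveRatios x fun j => A⁻¹ j i).eq_empty_or_nonempty with he | hne
  · rw [theta_eq_zero he, theta_eq_zero (h ▸ he)]
  · exact (isLeast_theta hne).unique (h ▸ isLeast_theta (h ▸ hne))

theorem reduceStep_apply (j : ι) : reduceStep A x i j = x j - theta A x i * A⁻¹ j i := by
  simp [reduceStep]

theorem mulVec_reduceStep (hA : A.det ≠ 0) :
    A.mulVec (reduceStep A x i) = A.mulVec x - theta A x i • Pi.single i 1 := by
  rw [reduceStep, Matrix.mulVec_sub, Matrix.mulVec_smul, Matrix.mulVec_mulVec,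
    Matrix.mul_nonsing_inv _ (isUnit_iff_ne_zero.mpr hA), Matrix.one_mulVec]

theorem exists_reduceStep_eq_zero {k : ι} (hk : 0 < A⁻¹ k i) :
    ∃ j, 0 < A⁻¹ j i ∧ reduceStep A x i j = 0 := by
  obtain ⟨j, hj, hθ⟩ := (isLeast_theta (x := x) ⟨_, k, hk, rfl⟩).1
  exact ⟨j, hj, by rw [reduceStep_apply, ← hθ, div_mul_cancel₀ _ hj.ne', sub_self]⟩

variable [IsStrictOrderedRing K]

theorem theta_nonneg (hx : ∀ j, 0 ≤ x j) : 0 ≤ theta A x i := by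
  rcases (positiveRatios x fun j => A⁻¹ j i).eq_empty_or_nonempty with he | hne
  · exact (theta_eq_zero he).ge
  · obtain ⟨j, hj, hθ⟩ := (isLeast_theta hne).1
    exact hθ ▸ div_nonneg (hx j) hj.le

theorem reduceStep_nonneg (hx : ∀ j, 0 ≤ x j) (j : ι) : 0 ≤ reduceStep A x i j := by
  rw [reduceStep_apply, sub_nonneg]
  rcases lt_or_ge 0 (A⁻¹ j i) with hj | hj
  · have hmem : x j / A⁻¹ j i ∈ positiveRatios x fun j => A⁻¹ j i := ⟨j, hj, rfl⟩
    exact (le_div_iff₀ hj).mp ((isLeast_theta ⟨_, hmem⟩).2 hmem)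
  · exact (mul_nonpos_of_nonneg_of_nonpos (theta_nonneg hx) hj).trans (hx j)

end Theta

section MinRatio

variable {K : Type} [Field K] [LinearOrder K] {k : ℕ} {x b : Fin (k + 1) → K}

theorem positiveRatios_succ_of_nonpos (h : b 0 ≤ 0) :
    positiveRatios x b = positiveRatios (fun j : Fin k => x j.succ) fun j => b j.succ := by
  ext r
  simp [positiveRatios, Fin.exists_fin_succ, h.not_gt]

theorem positiveRatios_succ_of_pos (h : 0 < b 0) :
    positiveRatios x b =
      insert (x 0 / b 0) (positiveRatios (fun j : Fin k => x j.succ) fun j => b j.succ) := by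
  ext r
  simp [positiveRatios, Fin.exists_fin_succ, h, eq_comm]

theorem run_minRatioProg (k : ℕ) (x b : Fin k → K) :
    (minRatioProg k x b).run.elim (positiveRatios x b = ∅) (IsLeast (positiveRatios x b)) := by
  induction k with
  | zero => simp [minRatioProg, positiveRatios]
  | succ k ih =>
    specialize ih (fun j => x j.succ) fun j => b j.succ
    rcases le_or_gt (b 0) 0 with hb | hb
    · simpa [minRatioProg, Instr.eval, hb, positiveRatios_succ_of_nonpos hb] using ih
    rw [positiveRatios_succ_of_pos hb]
    cases htail : (minRatioProg k (fun j => x j.succ) fun j => b j.succ).run with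
    | none =>
      rw [htail] at ih
      simp [minRatioProg, Instr.eval, hb.not_ge, htail, show positiveRatios _ _ = ∅ from ih]
    | some s =>
      rw [htail] at ih
      have hmin := IsLeast.insert (x 0 / b 0) ih
      rcases le_or_gt (x 0 / b 0) s with hle | hlt
      · simpa [minRatioProg, Instr.eval, hb.not_ge, htail, hle] using hmin
      · simpa [minRatioProg, Instr.eval, hb.not_ge, htail, hlt.not_ge, hlt.le] using hmin

theorem getD_run_minRatioProg {n : ℕ} (A : Matrix (Fin n) (Fin n) K) (x : Fin n → K) (i : Fin n) :
    (minRatioProg n x fun j => A⁻¹ j i).run.getD 0 = theta A x i := by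
  have h := run_minRatioProg n x fun j => A⁻¹ j i
  cases hrun : (minRatioProg n x fun j => A⁻¹ j i).run with
  | none =>
    rw [hrun] at h
    exact (theta_eq_zero h).symm
  | some r =>
    rw [hrun] at h
    exact h.unique (isLeast_theta ⟨r, h.1⟩)

end MinRatio

section Reduction

variable {K : Type} [Field K] [LinearOrder K] {n : ℕ} {M : Matrix (Fin n) (Fin n) K}
  {α : Finset (Fin n)} {x : Fin n → K} {i : Fin n}

theorem mem_psupp {j : Fin n} : j ∈ psupp x ↔ 0 < x j := by
  simp [psupp]

theorem reduceOn_of_notMem {j : Fin n} (hj : j ∉ α) : reduceOn M α x i j = 0 :=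
  dif_neg fun h => hj h.2

theorem theta_padded (hdet : (principal M α).det ≠ 0) (i : α) :
    theta (padded M α) x i = theta (principal M α) (fun a => x a) i := by
  refine theta_congr (Set.ext fun r => ⟨?_, ?_⟩)
  · rintro ⟨j, hj, rfl⟩
    by_cases hjα : j ∈ α
    · refine ⟨⟨j, hjα⟩, ?_, ?_⟩ <;> simp_all [inv_padded M hdet]
    · simp [inv_padded M hdet, hjα] at hj
  · rintro ⟨j, hj, rfl⟩
    exact ⟨j, by simpa [inv_padded M hdet] using hj, by simp [inv_padded M hdet]⟩

theorem reduceOn_eq_reduceStep (hdet : (principal M α).det ≠ 0) (hx : ∀ j ∉ α, x j = 0)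
    (hi : i ∈ α) : reduceOn M α x i = reduceStep (padded M α) x i := by
  funext j
  have hinv := inv_padded M hdet ⟨i, hi⟩ j
  rw [reduceStep_apply, theta_padded hdet ⟨i, hi⟩, hinv, reduceOn]
  by_cases hj : j ∈ α
  · rw [dif_pos ⟨hi, hj⟩, reduceStep_apply, dif_pos hj]
  · simp [hj, hx]

theorem inv_padded_pos [IsStrictOrderedRing K] (hdet : 0 < (principal M α).det)
    (hdeti : 0 < (principal M (α.erase i)).det) : 0 < (padded M α)⁻¹ i i := by
  rw [Matrix.inv_def, Matrix.smul_apply, adjugate_padded, det_padded, Ring.inverse_eq_inv',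
    smul_eq_mul]
  positivity

/-- What the procedure maintains about the set `α` and the vector `x` of a call, with `x` extended
by zero outside `α`. -/
structure Admissible (M : Matrix (Fin n) (Fin n) K) (α : Finset (Fin n)) (x : Fin n → K) :
    Prop where
  pos : ∀ i ∈ α, 0 < x i
  zero : ∀ i ∉ α, x i = 0
  nonpos : ∀ i ∈ α, M.mulVec x i ≤ 0

namespace Admissible

theorem nonneg (h : Admissible M α x) (j : Fin n) : 0 ≤ x j := by
  by_cases hj : j ∈ α
  exacts [(h.pos j hj).le, (h.zero j hj).ge]

theorem exists_reduceOn_ne_zero (h : Admissible M α x) (hcard : 2 ≤ α.card)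
    (hdet : (principal M α).det ≠ 0) : ∃ i ∈ α, reduceOn M α x i ≠ 0 := by
  by_contra! hzero
  obtain ⟨i, hi, k, hk, hik⟩ := Finset.one_lt_card.mp hcard
  have hmul (l : Fin n) (hl : l ∈ α) :
      (padded M α).mulVec x = theta (padded M α) x l • Pi.single l 1 := by
    have hstep := mulVec_reduceStep (x := x) (i := l) (det_padded_ne_zero hdet)
    rw [← reduceOn_eq_reduceStep hdet h.zero hl, hzero l hl, Matrix.mulVec_zero] at hstep
    exact sub_eq_zero.mp hstep.symm
  have hθ : theta (padded M α) x i = 0 := by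
    simpa [hik] using congrFun ((hmul i hi).symm.trans (hmul k hk)) i
  have hxi := congrFun (hzero i hi) i
  rw [reduceOn_eq_reduceStep hdet h.zero hi, reduceStep_apply, hθ, zero_mul, sub_zero] at hxi
  exact (h.pos i hi).ne' hxi

variable [IsStrictOrderedRing K]

theorem det_nonpos_of_card_eq_one (h : Admissible M α x) (hcard : α.card = 1) :
    (principal M α).det ≤ 0 := by
  obtain ⟨a, rfl⟩ := Finset.card_eq_one.mp hcard
  have ha := Finset.mem_singleton_self a
  have hmul : M.mulVec x a = M a a * x a := by
    rw [Matrix.mulVec, dotProduct]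
    exact Finset.sum_eq_single a (fun j _ hj => by simp [h.zero j (by simpa using hj)]) (by simp)
  have hle := h.nonpos a ha
  rw [hmul] at hle
  rw [Matrix.det_eq_elem_of_card_eq_one (by simp) ⟨a, ha⟩]
  exact nonpos_of_mul_nonpos_left hle (h.pos a ha)

theorem reduceOn_nonneg (h : Admissible M α x) (hdet : (principal M α).det ≠ 0) (hi : i ∈ α)
    (j : Fin n) : 0 ≤ reduceOn M α x i j := by
  rw [reduceOn_eq_reduceStep hdet h.zero hi]
  exact reduceStep_nonneg h.nonneg j

theorem mulVec_reduceOn_nonpos (h : Admissible M α x) (hdet : (principal M α).det ≠ 0)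
    (hi : i ∈ α) {j : Fin n} (hj : j ∈ α) : M.mulVec (reduceOn M α x i) j ≤ 0 := by
  have hmul : M.mulVec (reduceOn M α x i) j =
      M.mulVec x j - theta (padded M α) x i * (Pi.single i 1 : Fin n → K) j := by
    rw [← padded_mulVec M (fun k => reduceOn_of_notMem) hj, reduceOn_eq_reduceStep hdet h.zero hi,
      mulVec_reduceStep (det_padded_ne_zero hdet), Pi.sub_apply, padded_mulVec M h.zero hj,
      Pi.smul_apply, smul_eq_mul]
  have hsingle : 0 ≤ (Pi.single i 1 : Fin n → K) j := by
    rw [Pi.single_apply]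
    split_ifs <;> simp
  rw [hmul, sub_nonpos]
  exact (h.nonpos j hj).trans (mul_nonneg (theta_nonneg h.nonneg) hsingle)

theorem psupp_reduceOn_nonempty (h : Admissible M α x) (hdet : (principal M α).det ≠ 0)
    (hi : i ∈ α) (hne : reduceOn M α x i ≠ 0) : (psupp (reduceOn M α x i)).Nonempty := by
  obtain ⟨j, hj⟩ := Function.ne_iff.mp hne
  exact ⟨j, mem_psupp.mpr ((h.reduceOn_nonneg hdet hi j).lt_of_ne' hj)⟩

theorem psupp_reduceOn_ssubset (h : Admissible M α x) (hdet : 0 < (principal M α).det)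
    (hi : i ∈ α) (hdeti : 0 < (principal M (α.erase i)).det) :
    psupp (reduceOn M α x i) ⊂ α := by
  obtain ⟨j, hj, hj0⟩ := exists_reduceStep_eq_zero (x := x) (inv_padded_pos hdet hdeti)
  rw [← reduceOn_eq_reduceStep hdet.ne' h.zero hi] at hj0
  have hsub : psupp (reduceOn M α x i) ⊆ α := fun k hk => by
    by_contra hkα
    simp [mem_psupp, reduceOn_of_notMem hkα] at hk
  refine (Finset.ssubset_iff_of_subset hsub).mpr ⟨j, ?_, by simp [mem_psupp, hj0]⟩
  by_contra hjα
  have hinv := inv_padded M hdet.ne' ⟨i, hi⟩ j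
  rw [dif_neg hjα] at hinv
  exact hj.ne' hinv

theorem psupp_reduceOn (h : Admissible M α x) (hdet : 0 < (principal M α).det) (hi : i ∈ α)
    (hdeti : 0 < (principal M (α.erase i)).det) :
    Admissible M (psupp (reduceOn M α x i)) (reduceOn M α x i) where
  pos _ hj := mem_psupp.mp hj
  zero j hj := ((not_lt.mp (mt mem_psupp.mpr hj)).antisymm (h.reduceOn_nonneg hdet.ne' hi j))
  nonpos _ hj :=
    h.mulVec_reduceOn_nonpos hdet.ne' hi ((h.psupp_reduceOn_ssubset hdet hi hdeti).subset hj)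

end Admissible

end Reduction

/-! ### The recursive procedure -/

section Subprograms

variable {ρ : Type} {n : ℕ}

/-- The part of `reduceProg` that computes the step size `θ` from the vector `x` and the column `b`
of the inverse. -/
def stepSizeProg (x b : Fin n → ρ) : Prog ρ ρ := do
  let m ← minRatioProg n x b
  match m with
  | some s => pure s
  | none => instr (.lit 0)

/-- The part of `reduceProg` that computes `x - θ b`. -/
def updateProg (x b : Fin n → ρ) (θ : ρ) : Prog ρ (Fin n → ρ) :=
  tabulate n fun j => do
    let p ← instr (.arith .mul θ (b j))
    instr (.arith .sub (x j) p)

/-- The part of `recursiveFindProg` that looks for a nonpositive minor of size one less. -/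
def minorSearchProg (M : Matrix (Fin n) (Fin n) ρ) (α : Finset (Fin n)) :
    Prog ρ (Option (Finset (Fin n))) :=
  firstSome n fun i =>
    if i ∈ α then do
      scanProg n
      let c ← minorNonposProg M (α.erase i)
      if c then pure (some (α.erase i)) else pure none
    else pure none

/-- The part of `recursiveFindProg` that looks for a nonzero reduction. -/
def reductionSearchProg (M : Matrix (Fin n) (Fin n) ρ) (α : Finset (Fin n)) (x : Fin n → ρ) :
    Prog ρ (Option (Fin n → ρ)) :=
  firstSome n fun i =>
    if i ∈ α then do
      let y ← reduceProg M α x i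
      let c ← nonzeroProg y
      if c then pure (some y) else pure none
    else pure none

variable (M : Matrix (Fin n) (Fin n) ρ) (α : Finset (Fin n)) (x : Fin n → ρ)

theorem reduceProg_eq (i : Fin n) : reduceProg M α x i =
    (padProg M α).bind fun B => (invColProg B i).bind fun b =>
      (stepSizeProg x b).bind fun θ => updateProg x b θ := by
  simp only [stepSizeProg, bind_eq, bind_assoc]
  refine congrArg _ (funext fun B => congrArg _ (funext fun b => congrArg _ (funext fun m => ?_)))
  cases m <;> rfl

theorem recursiveFindProg_succ (t : ℕ) :
    recursiveFindProg M (t + 1) α x = (scanProg n).bind fun _ =>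
      if α.card = 1 then ret α else (minorNonposProg M α).bind fun b =>
        if b then ret α else (minorSearchProg M α).bind fun r =>
          match r with
          | some γ => ret γ
          | none => (reductionSearchProg M α x).bind fun s =>
            match s with
            | some y => (psuppProg y).bind fun γ => recursiveFindProg M t γ y
            | none => ret ∅ :=
  rfl

end Subprograms

section Run

variable {K : Type} [Field K] [LinearOrder K] {n : ℕ}

theorem run_stepSizeProg (x b : Fin n → K) :
    (stepSizeProg x b).run = (minRatioProg n x b).run.getD 0 := by
  cases h : (minRatioProg n x b).run <;> simp [stepSizeProg, h, Instr.eval]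

theorem run_updateProg (x b : Fin n → K) (θ : K) :
    (updateProg x b θ).run = fun j => x j - θ * b j := by
  simp [updateProg, Instr.eval]

theorem run_nonzeroProg (y : Fin n → K) : (nonzeroProg y).run = decide (y ≠ 0) := by
  have hentry (j : Fin n) : (if y j ≤ 0 ∧ 0 ≤ y j then none else some ()).isSome ↔ y j ≠ 0 := by
    simp [← le_antisymm_iff]
  rw [Bool.eq_iff_iff]
  simp [nonzeroProg, run_firstSome, Instr.eval, Function.ne_iff, apply_ite Prog.run, hentry]

theorem run_psuppProg (y : Fin n → K) : (psuppProg y).run = psupp y := by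
  simp [psuppProg, psupp, Instr.eval]

variable [CharZero K] (M : Matrix (Fin n) (Fin n) K) {α : Finset (Fin n)} {x : Fin n → K}

theorem run_minorNonposProg (α : Finset (Fin n)) :
    (minorNonposProg M α).run = decide ((principal M α).det ≤ 0) := by
  simp [minorNonposProg, run_padProg, run_detProg, det_padded, Instr.eval]

theorem run_reduceProg (hdet : (principal M α).det ≠ 0) (hx : ∀ j ∉ α, x j = 0) {i : Fin n}
    (hi : i ∈ α) : (reduceProg M α x i).run = reduceOn M α x i := by
  rw [reduceOn_eq_reduceStep hdet hx hi]
  funext j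
  simp [reduceProg_eq, run_padProg, run_invColProg _ (det_padded_ne_zero hdet), run_stepSizeProg,
    getD_run_minRatioProg, run_updateProg, reduceStep_apply]

/-- The least `i ∈ α` with `det M_{α∖{i},α∖{i}} ≤ 0`. -/
noncomputable def minorIndex (M : Matrix (Fin n) (Fin n) K) (α : Finset (Fin n)) :
    Option (Fin n) :=
  (List.finRange n).find? fun i => decide (i ∈ α ∧ (principal M (α.erase i)).det ≤ 0)

/-- The least `i ∈ α` whose reduction is nonzero. -/
noncomputable def reductionIndex (M : Matrix (Fin n) (Fin n) K) (α : Finset (Fin n))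
    (x : Fin n → K) : Option (Fin n) :=
  (List.finRange n).find? fun i => decide (i ∈ α ∧ reduceOn M α x i ≠ 0)

theorem run_minorSearchProg (α : Finset (Fin n)) :
    (minorSearchProg M α).run = (minorIndex M α).map α.erase := by
  refine run_firstSome_eq_find? _ _ _ _ fun i => ?_
  by_cases hi : i ∈ α
  · by_cases hd : (principal M (α.erase i)).det ≤ 0 <;> simp [hi, hd, run_minorNonposProg]
  · simp [hi]

theorem run_reductionSearchProg (hdet : (principal M α).det ≠ 0) (hx : ∀ j ∉ α, x j = 0) :
    (reductionSearchProg M α x).run = (reductionIndex M α x).map (reduceOn M α x) := by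
  refine run_firstSome_eq_find? _ _ _ _ fun i => ?_
  by_cases hi : i ∈ α
  · by_cases hy : reduceOn M α x i = 0 <;>
      simp [hi, hy, run_reduceProg M hdet hx hi, run_nonzeroProg]
  · simp [hi]

end Run

section Determinants

variable {K : Type} [Field K] [LinearOrder K] {n : ℕ}

@[simp]
theorem dets_padProg (M : Matrix (Fin n) (Fin n) K) (α : Finset (Fin n)) :
    (padProg M α).dets = 0 := by
  simp [padProg, apply_ite Prog.dets, Instr.detWeight]

@[simp]
theorem dets_leverrier (B : Fin n → Fin n → K) (m : ℕ) : (leverrier B m).dets = 0 := by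
  induction m with
  | zero => simp [leverrier, identityProg, apply_ite Prog.dets, Instr.detWeight]
  | succ m ih => simp [leverrier, mulProg, ih, apply_ite Prog.dets, Instr.detWeight]

@[simp]
theorem dets_detProg (B : Fin n → Fin n → K) : (detProg B).dets = 1 := by
  simp [detProg, apply_ite Prog.dets, Instr.detWeight]

@[simp]
theorem dets_invColProg (B : Fin n → Fin n → K) (i : Fin n) : (invColProg B i).dets = 0 := by
  simp [invColProg, Instr.detWeight]

@[simp]
theorem dets_minRatioProg (k : ℕ) (x b : Fin k → K) : (minRatioProg k x b).dets = 0 := by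
  induction k with
  | zero => simp [minRatioProg]
  | succ k ih =>
    cases h : (minRatioProg k (fun j => x j.succ) fun j => b j.succ).run <;>
      simp [minRatioProg, ih, h, apply_ite Prog.dets, Instr.detWeight]

@[simp]
theorem dets_reduceProg (M : Matrix (Fin n) (Fin n) K) (α : Finset (Fin n)) (x : Fin n → K)
    (i : Fin n) : (reduceProg M α x i).dets = 0 := by
  have hstep (b : Fin n → K) : (stepSizeProg x b).dets = 0 := by
    cases h : (minRatioProg n x b).run <;> simp [stepSizeProg, h, Instr.detWeight]
  simp [reduceProg_eq, hstep, updateProg, Instr.detWeight]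

@[simp]
theorem dets_nonzeroProg (y : Fin n → K) : (nonzeroProg y).dets = 0 := by
  simp only [nonzeroProg, bind_eq, dets_bind]
  refine Nat.le_zero.mp ((Nat.add_le_add_right (dets_firstSome_le _ _) _).trans ?_)
  simp [apply_ite Prog.dets, Instr.detWeight]

@[simp]
theorem dets_psuppProg (y : Fin n → K) : (psuppProg y).dets = 0 := by
  simp [psuppProg, Instr.detWeight]

@[simp]
theorem dets_scanProg : (scanProg n : Prog K Unit).dets = 0 := by
  simp [scanProg]

@[simp]
theorem dets_minorNonposProg (M : Matrix (Fin n) (Fin n) K) (α : Finset (Fin n)) :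
    (minorNonposProg M α).dets = 1 := by
  simp [minorNonposProg, Instr.detWeight]

theorem dets_minorSearchProg_le (M : Matrix (Fin n) (Fin n) K) (α : Finset (Fin n)) :
    (minorSearchProg M α).dets ≤ α.card := by
  refine (dets_firstSome_le _ _).trans ?_
  simp [apply_ite Prog.dets]

@[simp]
theorem dets_reductionSearchProg (M : Matrix (Fin n) (Fin n) K) (α : Finset (Fin n))
    (x : Fin n → K) : (reductionSearchProg M α x).dets = 0 := by
  refine Nat.le_zero.mp ((dets_firstSome_le _ _).trans ?_)
  simp [apply_ite Prog.dets]

end Determinants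

section Correctness

variable {K : Type} [Field K] [LinearOrder K] {n : ℕ} {M : Matrix (Fin n) (Fin n) K}

theorem minorIndex_eq_some {α : Finset (Fin n)} {i : Fin n} (h : minorIndex M α = some i) :
    i ∈ α ∧ (principal M (α.erase i)).det ≤ 0 := by
  simpa using List.find?_some h

theorem minorIndex_eq_none {α : Finset (Fin n)} :
    minorIndex M α = none ↔ ∀ i ∈ α, 0 < (principal M (α.erase i)).det := by
  simp [minorIndex]

theorem reductionIndex_eq_some {α : Finset (Fin n)} {x : Fin n → K} {i : Fin n}
    (h : reductionIndex M α x = some i) : i ∈ α ∧ reduceOn M α x i ≠ 0 := by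
  simpa using List.find?_some h

theorem reductionIndex_eq_none {α : Finset (Fin n)} {x : Fin n → K} :
    reductionIndex M α x = none ↔ ∀ i ∈ α, reduceOn M α x i = 0 := by
  simp [reductionIndex]

theorem recursiveFind_of_direct (t : ℕ) {α : Finset (Fin n)} (x : Fin n → K)
    (hdirect : α.card = 1 ∨ (principal M α).det ≤ 0) : recursiveFind M (t + 1) α x = α := by
  simp only [recursiveFind, if_pos hdirect]

theorem recursiveFind_of_minorIndex (t : ℕ) {α : Finset (Fin n)} (x : Fin n → K) {i : Fin n}
    (hdirect : ¬(α.card = 1 ∨ (principal M α).det ≤ 0)) (hminor : minorIndex M α = some i) :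
    recursiveFind M (t + 1) α x = α.erase i := by
  unfold minorIndex at hminor
  simp only [recursiveFind, if_neg hdirect, hminor]

theorem recursiveFind_of_reductionIndex (t : ℕ) {α : Finset (Fin n)} {x : Fin n → K} {i : Fin n}
    (hdirect : ¬(α.card = 1 ∨ (principal M α).det ≤ 0)) (hminor : minorIndex M α = none)
    (hreduction : reductionIndex M α x = some i) :
    recursiveFind M (t + 1) α x =
      recursiveFind M t (psupp (reduceOn M α x i)) (reduceOn M α x i) := by
  unfold minorIndex at hminor
  unfold reductionIndex at hreduction
  simp only [recursiveFind, if_neg hdirect, hminor, hreduction]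

variable [IsStrictOrderedRing K]

theorem Admissible.call_induction {C : ℕ → Finset (Fin n) → (Fin n → K) → Prop}
    (direct : ∀ {t α x}, Admissible M α x → α.Nonempty →
      (α.card = 1 ∨ (principal M α).det ≤ 0) → C (t + 1) α x)
    (minor : ∀ {t α x i}, Admissible M α x → ¬(α.card = 1 ∨ (principal M α).det ≤ 0) →
      minorIndex M α = some i → C (t + 1) α x)
    (reduce : ∀ {t α x i}, Admissible M α x → ¬(α.card = 1 ∨ (principal M α).det ≤ 0) →
      minorIndex M α = none → reductionIndex M α x = some i →
      psupp (reduceOn M α x i) ⊂ α →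
      C t (psupp (reduceOn M α x i)) (reduceOn M α x i) → C (t + 1) α x)
    {t : ℕ} {α : Finset (Fin n)} {x : Fin n → K} (h : Admissible M α x) (hα : α.Nonempty)
    (ht : α.card ≤ t) : C t α x := by
  induction t generalizing α x with
  | zero => exact absurd (Nat.le_zero.mp ht) hα.card_ne_zero
  | succ t ih =>
    by_cases hdirect : α.card = 1 ∨ (principal M α).det ≤ 0
    · exact direct h hα hdirect
    obtain ⟨hcard, hdet⟩ := not_or.mp hdirect
    rw [not_le] at hdet
    cases hminor : minorIndex M α with
    | some i => exact minor h hdirect hminor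
    | none =>
      cases hreduction : reductionIndex M α x with
      | none =>
        have hcard2 : 2 ≤ α.card := lt_of_le_of_ne hα.card_pos (Ne.symm hcard)
        obtain ⟨i, hi, hne⟩ := h.exists_reduceOn_ne_zero hcard2 hdet.ne'
        exact absurd (reductionIndex_eq_none.mp hreduction i hi) hne
      | some i =>
        obtain ⟨hi, hne⟩ := reductionIndex_eq_some hreduction
        have hdeti := minorIndex_eq_none.mp hminor i hi
        have hssubset := h.psupp_reduceOn_ssubset hdet hi hdeti
        refine reduce h hdirect hminor hreduction hssubset (ih (h.psupp_reduceOn hdet hi hdeti)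
          (h.psupp_reduceOn_nonempty hdet.ne' hi hne) ?_)
        have := Finset.card_lt_card hssubset
        lia

variable {t : ℕ} {α : Finset (Fin n)} {x : Fin n → K}

theorem det_principal_recursiveFind_nonpos (h : Admissible M α x) (hα : α.Nonempty)
    (ht : α.card ≤ t) : (principal M (recursiveFind M t α x)).det ≤ 0 := by
  refine h.call_induction (C := fun t α x => (principal M (recursiveFind M t α x)).det ≤ 0)
    ?_ ?_ ?_ hα ht
  · intro t α x h _ hdirect
    rw [recursiveFind_of_direct t x hdirect]
    exact hdirect.elim h.det_nonpos_of_card_eq_one id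
  · intro t α x i _ hdirect hminor
    rw [recursiveFind_of_minorIndex t x hdirect hminor]
    exact (minorIndex_eq_some hminor).2
  · intro t α x i _ hdirect hminor hreduction _ ih
    rwa [recursiveFind_of_reductionIndex t hdirect hminor hreduction]

theorem run_recursiveFindProg (h : Admissible M α x) (hα : α.Nonempty) (ht : α.card ≤ t) :
    (recursiveFindProg M t α x).run = recursiveFind M t α x := by
  refine h.call_induction
    (C := fun t α x => (recursiveFindProg M t α x).run = recursiveFind M t α x) ?_ ?_ ?_ hα ht
  · intro t α x _ _ hdirect
    rw [recursiveFind_of_direct t x hdirect]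
    by_cases hcard : α.card = 1
    · simp [recursiveFindProg_succ, hcard]
    · have hdet := hdirect.resolve_left hcard
      simp [recursiveFindProg_succ, hcard, run_minorNonposProg, hdet]
  · intro t α x i _ hdirect hminor
    have ⟨hcard, hdet⟩ := not_or.mp hdirect
    rw [recursiveFind_of_minorIndex t x hdirect hminor]
    simp [recursiveFindProg_succ, hcard, hdet, run_minorNonposProg,
      run_minorSearchProg, hminor]
  · intro t α x i h hdirect hminor hreduction _ ih
    have ⟨hcard, hdet⟩ := not_or.mp hdirect
    rw [recursiveFind_of_reductionIndex t hdirect hminor hreduction]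
    simp [recursiveFindProg_succ, hcard, hdet, run_minorNonposProg,
      run_minorSearchProg, hminor, run_reductionSearchProg M (not_le.mp hdet).ne' h.zero,
      hreduction, run_psuppProg, ih]

theorem two_mul_dets_recursiveFindProg_le (h : Admissible M α x) (hα : α.Nonempty)
    (ht : α.card ≤ t) : 2 * (recursiveFindProg M t α x).dets ≤ α.card * (α.card + 3) := by
  refine h.call_induction
    (C := fun t α x => 2 * (recursiveFindProg M t α x).dets ≤ α.card * (α.card + 3)) ?_ ?_ ?_ hα ht
  · intro t α x _ hα hdirect
    have hdets : (recursiveFindProg M (t + 1) α x).dets ≤ 1 := by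
      by_cases hcard : α.card = 1
      · simp [recursiveFindProg_succ, hcard]
      · have hdet := hdirect.resolve_left hcard
        simp [recursiveFindProg_succ, hcard, run_minorNonposProg, hdet]
    nlinarith [hα.card_pos]
  · intro t α x i _ hdirect hminor
    have ⟨hcard, hdet⟩ := not_or.mp hdirect
    have hdets : (recursiveFindProg M (t + 1) α x).dets = 1 + (minorSearchProg M α).dets := by
      simp [recursiveFindProg_succ, hcard, hdet, run_minorNonposProg, run_minorSearchProg, hminor]
    have hpos : 0 < α.card := Finset.card_pos.mpr ⟨i, (minorIndex_eq_some hminor).1⟩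
    nlinarith [dets_minorSearchProg_le M α]
  · intro t α x i h hdirect hminor hreduction hssubset ih
    have ⟨hcard, hdet⟩ := not_or.mp hdirect
    have hdets : (recursiveFindProg M (t + 1) α x).dets = 1 + ((minorSearchProg M α).dets +
        (recursiveFindProg M t (psupp (reduceOn M α x i)) (reduceOn M α x i)).dets) := by
      simp [recursiveFindProg_succ, hcard, hdet, run_minorNonposProg, run_minorSearchProg, hminor,
        run_reductionSearchProg M (not_le.mp hdet).ne' h.zero, hreduction, run_psuppProg]
    nlinarith [dets_minorSearchProg_le M α, Finset.card_lt_card hssubset]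

end Correctness

/-! ### Steps -/

section StepBounds

variable {R : Type*} [Semiring R]

/-- A bound for the number of steps to write an `n × n` table with at most one step per entry. The
bounds are defined over an arbitrary semiring in order to serve both as numbers and as
polynomials. -/
def tableSteps (n : R) : R := n * (1 + n * 2)

/-- A bound for the number of steps of one round of the Faddeev–LeVerrier method. -/
def roundSteps (n : R) : R := n * (1 + n * (2 + n * 3)) + (1 + n * 2) + 4 + tableSteps n

/-- A bound for the number of steps of at most `n` rounds of the Faddeev–LeVerrier method. -/
def leverrierSteps (n : R) : R := tableSteps n + 1 + n * roundSteps n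

/-- A bound for the number of steps of `minorNonposProg`. -/
def minorSteps (n : R) : R := tableSteps n + (leverrierSteps n + 3) + 2

/-- A bound for the number of steps of `reduceProg`. -/
def reduceSteps (n : R) : R :=
  tableSteps n + (2 * leverrierSteps n + 2 + n * 2) + (n * 5 + 1) + n * 3

/-- A bound for the number of steps of one call of the recursive procedure. -/
def callSteps (n : R) : R :=
  n + minorSteps n + n * (1 + (n + minorSteps n)) + n * (1 + (reduceSteps n + n * 4)) + n * 3

/-- A bound for the number of steps of the whole procedure. -/
def totalSteps (n : R) : R := n * callSteps n

theorem eval_totalSteps (n : ℕ) :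
    (totalSteps (Polynomial.X : Polynomial ℕ)).eval n = totalSteps n := by
  simp [totalSteps, callSteps, reduceSteps, minorSteps, leverrierSteps, roundSteps, tableSteps]

theorem totalSteps_mono : Monotone (totalSteps : ℕ → ℕ) := by
  intro m n h
  simp only [totalSteps, callSteps, reduceSteps, minorSteps, leverrierSteps, roundSteps,
    tableSteps]
  gcongr

end StepBounds

section Steps

variable {K : Type} [Field K] [LinearOrder K] {n : ℕ} {β : Type}

theorem steps_tabulate_le {k c : ℕ} {f : Fin k → Prog K β} (h : ∀ i, (f i).steps ≤ c) :
    (tabulate k f).steps ≤ k * (1 + c) := by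
  rw [steps_tabulate]
  simpa using Finset.sum_le_card_nsmul Finset.univ _ _ fun i _ => Nat.add_le_add_left (h i) 1

theorem steps_firstSome_le_mul {k c : ℕ} {f : Fin k → Prog K (Option β)}
    (h : ∀ i, (f i).steps ≤ c) : (firstSome k f).steps ≤ k * (1 + c) := by
  refine (steps_firstSome_le k f).trans ?_
  simpa using Finset.sum_le_card_nsmul Finset.univ _ _ fun i _ => Nat.add_le_add_left (h i) 1

theorem steps_table_le {f : Fin n → Fin n → Prog K β} (h : ∀ i j, (f i j).steps ≤ 1) :
    (tabulate n fun i => tabulate n fun j => f i j).steps ≤ tableSteps n :=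
  steps_tabulate_le fun i => steps_tabulate_le (h i)

theorem steps_padProg_le (M : Matrix (Fin n) (Fin n) K) (α : Finset (Fin n)) :
    (padProg M α).steps ≤ tableSteps n :=
  steps_table_le fun i j => by split_ifs <;> simp

theorem steps_mulProg (A B : Fin n → Fin n → K) :
    (mulProg A B).steps = n * (1 + n * (2 + n * 3)) := by
  simp only [mulProg, steps_tabulate, steps_sumProg, steps_instr, Finset.sum_const,
    Finset.card_univ, Fintype.card_fin, smul_eq_mul]
  ring

theorem steps_leverrier_le (B : Fin n → Fin n → K) (m : ℕ) :
    (leverrier B m).steps ≤ tableSteps n + 1 + m * roundSteps n := by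
  induction m with
  | zero =>
    have hidentity : (identityProg (ρ := K) (n := n)).steps ≤ tableSteps n :=
      steps_table_le fun i j => by split_ifs <;> simp
    simpa [leverrier] using hidentity
  | succ m ih =>
    have htable (P : Fin n → Fin n → K) (c : K) :
        (tabulate n fun i => tabulate n fun j => if i = j then instr (.arith .add (P i j) c)
          else (ret (P i j))).steps ≤ tableSteps n :=
      steps_table_le fun i j => by split_ifs <;> simp
    simp only [leverrier, bind_eq, pure_eq, steps_bind, steps_ret, steps_instr, steps_mulProg,
      steps_sumProg, Finset.sum_const, Finset.card_univ, Fintype.card_fin, smul_eq_mul]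
    grw [ih, htable]
    rw [roundSteps]
    lia

theorem steps_leverrier_le_of_le (B : Fin n → Fin n → K) {m : ℕ} (hm : m ≤ n) :
    (leverrier B m).steps ≤ leverrierSteps n :=
  (steps_leverrier_le B m).trans (Nat.add_le_add_left (Nat.mul_le_mul_right _ hm) _)

theorem steps_detProg_le (B : Fin n → Fin n → K) : (detProg B).steps ≤ leverrierSteps n + 3 := by
  have hleverrier := steps_leverrier_le_of_le B le_rfl
  simp only [detProg, bind_eq, pure_eq, steps_bind, steps_instr]
  split_ifs <;> simp only [steps_ret, steps_bind, steps_instr] <;> lia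

theorem steps_invColProg_le (B : Fin n → Fin n → K) (i : Fin n) :
    (invColProg B i).steps ≤ 2 * leverrierSteps n + 2 + n * 2 := by
  have hpred := steps_leverrier_le_of_le B (Nat.sub_le n 1)
  have hself := steps_leverrier_le_of_le B le_rfl
  simp only [invColProg, bind_eq, steps_bind, steps_instr, steps_tabulate, Finset.sum_const,
    Finset.card_univ, Fintype.card_fin, smul_eq_mul]
  lia

theorem steps_minRatioProg_le (k : ℕ) (x b : Fin k → K) : (minRatioProg k x b).steps ≤ k * 5 := by
  induction k with
  | zero => simp [minRatioProg]
  | succ k ih =>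
    have htail := ih (fun j => x j.succ) fun j => b j.succ
    simp only [minRatioProg, bind_eq, pure_eq, steps_bind, steps_instr, apply_ite Prog.steps]
    cases (minRatioProg k (fun j => x j.succ) fun j => b j.succ).run <;>
      simp only [steps_ret, steps_bind, steps_instr, apply_ite Prog.steps, ite_self] <;>
      split_ifs <;> lia

theorem steps_stepSizeProg_le (x b : Fin n → K) : (stepSizeProg x b).steps ≤ n * 5 + 1 := by
  have hratio := steps_minRatioProg_le n x b
  cases h : (minRatioProg n x b).run <;> simp [stepSizeProg, h] <;> lia

theorem steps_reduceProg_le (M : Matrix (Fin n) (Fin n) K) (α : Finset (Fin n)) (x : Fin n → K)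
    (i : Fin n) : (reduceProg M α x i).steps ≤ reduceSteps n := by
  have hpad := steps_padProg_le M α
  have hcol := steps_invColProg_le (padProg M α).run i
  have hstep := steps_stepSizeProg_le x (invColProg (padProg M α).run i).run
  have hupdate (b : Fin n → K) (θ : K) : (updateProg x b θ).steps = n * 3 := by
    simp [updateProg]
  simp only [reduceProg_eq, steps_bind, hupdate, reduceSteps]
  lia

theorem steps_nonzeroProg_le (y : Fin n → K) : (nonzeroProg y).steps ≤ n * 4 := by
  simp only [nonzeroProg, bind_eq, pure_eq, steps_bind, steps_ret, add_zero]
  refine steps_firstSome_le_mul (K := K) (c := 3) fun j => ?_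
  simp [apply_ite Prog.steps]

theorem steps_psuppProg (y : Fin n → K) : (psuppProg y).steps = n * 3 := by
  simp [psuppProg]

theorem steps_scanProg : (scanProg n : Prog K Unit).steps = n := by
  simp [scanProg]

theorem steps_minorNonposProg_le (M : Matrix (Fin n) (Fin n) K) (α : Finset (Fin n)) :
    (minorNonposProg M α).steps ≤ minorSteps n := by
  have hpad := steps_padProg_le M α
  have hdet := steps_detProg_le (padProg M α).run
  simp only [minorNonposProg, bind_eq, steps_bind, steps_instr, minorSteps]
  lia

theorem steps_minorSearchProg_le (M : Matrix (Fin n) (Fin n) K) (α : Finset (Fin n)) :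
    (minorSearchProg M α).steps ≤ n * (1 + (n + minorSteps n)) := by
  refine steps_firstSome_le_mul fun i => ?_
  have hminor := steps_minorNonposProg_le M (α.erase i)
  by_cases hi : i ∈ α
  · simpa [hi, steps_scanProg, apply_ite Prog.steps] using hminor
  · simp [hi]

theorem steps_reductionSearchProg_le (M : Matrix (Fin n) (Fin n) K) (α : Finset (Fin n))
    (x : Fin n → K) :
    (reductionSearchProg M α x).steps ≤ n * (1 + (reduceSteps n + n * 4)) := by
  refine steps_firstSome_le_mul fun i => ?_
  have hreduce := steps_reduceProg_le M α x i
  have hnonzero := steps_nonzeroProg_le (reduceProg M α x i).run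
  by_cases hi : i ∈ α
  · simpa [hi, apply_ite Prog.steps] using add_le_add hreduce hnonzero
  · simp [hi]

theorem steps_recursiveFindProg_le (M : Matrix (Fin n) (Fin n) K) (t : ℕ) (α : Finset (Fin n))
    (x : Fin n → K) : (recursiveFindProg M t α x).steps ≤ t * callSteps n := by
  induction t generalizing α x with
  | zero => simp [recursiveFindProg]
  | succ t ih =>
    have hminor := steps_minorNonposProg_le M α
    have hminorSearch := steps_minorSearchProg_le M α
    have hreductionSearch := steps_reductionSearchProg_le M α x
    rw [add_mul, one_mul]
    generalize t * callSteps n = T at ih ⊢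
    simp only [recursiveFindProg_succ, steps_bind, steps_scanProg, callSteps]
    split_ifs
    · rw [steps_ret]
      lia
    rw [steps_bind]
    split_ifs
    · rw [steps_ret]
      lia
    rw [steps_bind]
    cases (minorSearchProg M α).run with
    | some γ =>
      simp only [steps_ret]
      lia
    | none =>
      rw [steps_bind]
      cases (reductionSearchProg M α x).run with
      | none =>
        simp only [steps_ret]
        lia
      | some y =>
        have htail := ih (psuppProg y).run y
        simp only [steps_bind, steps_psuppProg]
        lia

end Steps

/-! ### Bit lengths -/

section BitLength

theorem size_mul_le (a b : ℕ) : (a * b).size ≤ a.size + b.size := by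
  rw [Nat.size_le, pow_add]
  exact Nat.mul_lt_mul'' a.lt_size_self b.lt_size_self

theorem size_le_of_dvd_mul {a b c : ℕ} (h : a ∣ b * c) (h0 : b * c ≠ 0) :
    a.size ≤ b.size + c.size :=
  (Nat.size_le_size (Nat.le_of_dvd (Nat.pos_of_ne_zero h0) h)).trans (size_mul_le b c)

theorem num_mul_dvd (a b : ℚ) : (a * b).num ∣ a.num * b.num :=
  ⟨(a.num * b.num).natAbs.gcd (a.den * b.den), by
    rw [Rat.num_mul]
    exact (Int.ediv_mul_cancel (Int.natCast_dvd.mpr (Nat.gcd_dvd_left ..))).symm⟩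

theorem bitLength_mul_le (a b : ℚ) : bitLength (a * b) ≤ 2 * (bitLength a + bitLength b) := by
  have hden : (a * b).den.size ≤ a.den.size + b.den.size :=
    size_le_of_dvd_mul (Rat.mul_den_dvd a b) (mul_ne_zero a.den_nz b.den_nz)
  have hnum : (a * b).num.natAbs.size ≤ a.num.natAbs.size + b.num.natAbs.size := by
    rcases eq_or_ne (a * b) 0 with h | h
    · simp [h]
    · have hdvd := Int.natAbs_dvd_natAbs.mpr (num_mul_dvd a b)
      rw [Int.natAbs_mul] at hdvd
      exact size_le_of_dvd_mul hdvd (by simpa using h)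
  simp only [bitLength]
  lia

theorem bitLength_inv (a : ℚ) : bitLength a⁻¹ = bitLength a := by
  rcases eq_or_ne a 0 with rfl | h
  · rw [inv_zero]
  · have hnum : a⁻¹.num.natAbs = a.den := by
      rw [Rat.num_inv, Int.natAbs_mul, Int.natAbs_sign_of_ne_zero (Rat.num_ne_zero.mpr h), one_mul,
        Int.natAbs_natCast]
    rw [bitLength, bitLength, hnum, Rat.den_inv_of_ne_zero h, add_comm a.den.size]

theorem bitLength_div_le (a b : ℚ) : bitLength (a / b) ≤ 2 * (bitLength a + bitLength b) := by
  rw [div_eq_mul_inv, ← bitLength_inv b]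
  exact bitLength_mul_le a b⁻¹

end BitLength

section Box

/-- The rational numbers with denominator dividing `E` and absolute value at most `G`. In contrast
to bit lengths, common denominators do not grow under addition. -/
def box (E G : ℕ) : Set ℚ := {r | r.den ∣ E ∧ |r| ≤ G}

variable {E E' G G' : ℕ} {r s : ℚ}

theorem box_subset_box (hE : E ∣ E') (hG : G ≤ G') : box E G ⊆ box E' G' :=
  fun _ hr => ⟨hr.1.trans hE, hr.2.trans (Nat.cast_le.mpr hG)⟩

theorem natCast_mem_box {k : ℕ} (hk : k ≤ G) : (k : ℚ) ∈ box E G :=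
  ⟨by simp, by simpa using hk⟩

theorem zero_mem_box : 0 ∈ box E G := by
  exact_mod_cast natCast_mem_box G.zero_le

theorem one_mem_box (hG : 0 < G) : 1 ∈ box E G := by
  exact_mod_cast natCast_mem_box (k := 1) hG

theorem add_mem_box (hr : r ∈ box E G) (hs : s ∈ box E G') : r + s ∈ box E (G + G') :=
  ⟨(Rat.add_den_dvd_lcm r s).trans (Nat.lcm_dvd hr.1 hs.1),
    (abs_add_le r s).trans (by push_cast; exact add_le_add hr.2 hs.2)⟩

theorem neg_mem_box (hr : r ∈ box E G) : -r ∈ box E G := by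
  simpa [box] using hr

theorem mul_mem_box (hr : r ∈ box E G) (hs : s ∈ box E' G') : r * s ∈ box (E * E') (G * G') := by
  refine ⟨(Rat.mul_den_dvd r s).trans (mul_dvd_mul hr.1 hs.1), ?_⟩
  rw [abs_mul, Nat.cast_mul]
  exact mul_le_mul hr.2 hs.2 (abs_nonneg _) (Nat.cast_nonneg _)

theorem div_natCast_mem_box (hr : r ∈ box E G) {k : ℕ} (hk : k ≠ 0) : r / k ∈ box (E * k) G := by
  have hinv : (k : ℚ)⁻¹ ∈ box k 1 :=
    ⟨by simp [hk], by
      rw [abs_inv, Nat.abs_cast, Nat.cast_one]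
      exact inv_le_one_of_one_le₀ (by exact_mod_cast Nat.pos_of_ne_zero hk)⟩
  simpa [div_eq_mul_inv] using mul_mem_box hr hinv

theorem sum_mem_box {ι : Type*} [Fintype ι] {f : ι → ℚ} (hf : ∀ i, f i ∈ box E G)
    (T : Finset ι) : ∑ i ∈ T, f i ∈ box E (Fintype.card ι * G) := by
  classical
  suffices h : ∑ i ∈ T, f i ∈ box E (T.card * G) from
    box_subset_box dvd_rfl (Nat.mul_le_mul_right _ T.card_le_univ) h
  induction T using Finset.induction_on with
  | empty => simpa using zero_mem_box
  | insert a T ha ih =>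
    rw [Finset.sum_insert ha, Finset.card_insert_of_notMem ha, add_mul, one_mul, add_comm (_ * _)]
    exact add_mem_box (hf a) ih

theorem exists_int_of_mem_box (h : r ∈ box E G) : ∃ z : ℤ, r * E = z ∧ z.natAbs ≤ E * G := by
  obtain ⟨⟨c, rfl⟩, hG⟩ := h
  refine ⟨r.num * c, by push_cast; rw [← mul_assoc, Rat.mul_den_eq_num], ?_⟩
  have hnum : |(r.num : ℚ)| ≤ r.den * G := by
    rw [← Rat.mul_den_eq_num, abs_mul, Nat.abs_cast, mul_comm]
    gcongr
  have hcast : (r.num.natAbs : ℚ) ≤ (r.den * G : ℕ) := by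
    rw [Nat.cast_natAbs, Int.cast_abs]
    exact_mod_cast hnum
  rw [Int.natAbs_mul, Int.natAbs_natCast, mul_right_comm]
  exact Nat.mul_le_mul_right c (by exact_mod_cast hcast)

theorem bitLength_le_of_mem_box (h : r ∈ box E G) (hE0 : E ≠ 0) {a b : ℕ} (hE : E ≤ 2 ^ a)
    (hG : G ≤ 2 ^ b) : bitLength r ≤ 2 * a + b + 3 := by
  have hden : r.den ≤ 2 ^ a := (Nat.le_of_dvd (Nat.pos_of_ne_zero hE0) h.1).trans hE
  have hnum : r.num.natAbs ≤ 2 ^ (a + b) := by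
    obtain ⟨z, hz, hzG⟩ := exists_int_of_mem_box (E := r.den) ⟨dvd_rfl, h.2⟩
    rw [Rat.mul_den_eq_num, Int.cast_inj] at hz
    rw [hz, pow_add]
    exact hzG.trans (Nat.mul_le_mul hden hG)
  have hdenSize := Nat.size_le_size hden
  have hnumSize := Nat.size_le_size hnum
  rw [Nat.size_pow] at hdenSize hnumSize
  rw [bitLength]
  lia

theorem mem_box_den (r : ℚ) : r ∈ box r.den (2 ^ bitLength r) := by
  have hnum : |r| ≤ r.num.natAbs := by
    rw [Nat.cast_natAbs, Int.cast_abs, ← Rat.mul_den_eq_num, abs_mul, Nat.abs_cast]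
    exact le_mul_of_one_le_right (abs_nonneg _) (by exact_mod_cast r.den_pos)
  have hsize : r.num.natAbs ≤ 2 ^ bitLength r :=
    r.num.natAbs.lt_size_self.le.trans
      (Nat.pow_le_pow_right two_pos (by simp only [bitLength]; lia))
  exact ⟨dvd_rfl, hnum.trans (by exact_mod_cast hsize)⟩

end Box

section LeverrierNumbers

variable {K : Type} [Field K] [LinearOrder K] {n : ℕ} {s : Set K}

theorem numbersIn_identityProg (h0 : 0 ∈ s) (h1 : 1 ∈ s) :
    (identityProg (ρ := K) (n := n)).NumbersIn s := by
  simp only [identityProg, numbersIn_tabulate]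
  intro i j
  split_ifs <;> simp [Instr.NumbersIn, h0, h1]

theorem numbersIn_mulProg (A B : Matrix (Fin n) (Fin n) K) (hA : ∀ i j, A i j ∈ s)
    (hB : ∀ i j, B i j ∈ s) (hsum : ∀ i j T, ∑ l ∈ T, A i l * B l j ∈ s) :
    (mulProg A B).NumbersIn s := by
  simp only [mulProg, numbersIn_tabulate]
  exact fun i j => numbersIn_sumProg n _ (fun l => by simp [Instr.NumbersIn, hA, hB])
    (by simpa [Instr.eval] using hsum i j)

theorem numbersIn_leverrier_succ (B : Matrix (Fin n) (Fin n) K) (m : ℕ) (h0 : 0 ∈ s)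
    (hm : ((m + 1 : ℕ) : K) ∈ s) (hprev : (leverrier B m).NumbersIn s)
    (hmul : (mulProg B (leverrierMatrix B m)).NumbersIn s)
    (hentry : ∀ i j, (B * leverrierMatrix B m) i j ∈ s)
    (htrace : ∀ T, ∑ i ∈ T, (B * leverrierMatrix B m) i i ∈ s)
    (hneg : -(B * leverrierMatrix B m).trace ∈ s) (hscalar : leverrierScalar B (m + 1) ∈ s) :
    (leverrier B (m + 1)).NumbersIn s := by
  have htraceProg : (sumProg n fun i => ret ((B * leverrierMatrix B m) i i)).NumbersIn s :=
    numbersIn_sumProg n _ (fun _ => trivial) htrace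
  rw [leverrierScalar_succ] at hscalar
  simp only [leverrier, bind_eq, pure_eq, numbersIn_bind, numbersIn_instr, numbersIn_ret,
    run_leverrier, run_mulProg, run_sumProg, run_ret, run_instr, Instr.eval, numbersIn_tabulate,
    Nat.cast_zero, zero_sub, and_true]
  refine ⟨hprev, hmul, htraceProg, by simpa [Instr.NumbersIn] using h0, hm,
    ⟨h0, htrace Finset.univ⟩, ⟨hneg, hm⟩, fun i j => ?_⟩
  split_ifs
  · rw [numbersIn_instr]
    exact ⟨hentry i j, hscalar⟩
  · trivial

end LeverrierNumbers

section LeverrierBox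

open scoped Nat

/-- A box for the numbers of round `m` of the Faddeev–LeVerrier method for an `n × n` matrix with
entries in `box D H`: a round multiplies the common denominator by `D` and by the round number. -/
def leverrierBox (n D H m : ℕ) : Set ℚ := box (D ^ m * m !) ((2 * (n + 1) ^ 2 * H) ^ m)

variable {n D H m k : ℕ} {B N : Matrix (Fin n) (Fin n) ℚ}

theorem leverrierBox_mono (hH : 0 < H) : Monotone (leverrierBox n D H) := fun _ _ h =>
  box_subset_box (mul_dvd_mul (pow_dvd_pow D h) (Nat.factorial_dvd_factorial h))
    (Nat.pow_le_pow_right (by positivity) h)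

theorem natCast_mem_leverrierBox (hH : 0 < H) (hk : k ≤ m) : (k : ℚ) ∈ leverrierBox n D H m := by
  have hbase : 1 < 2 * (n + 1) ^ 2 * H := by nlinarith [Nat.zero_le n]
  exact natCast_mem_box (hk.trans (Nat.lt_pow_self hbase).le)

theorem zero_mem_leverrierBox : 0 ∈ leverrierBox n D H m := zero_mem_box

theorem one_mem_leverrierBox (hH : 0 < H) : 1 ∈ leverrierBox n D H m :=
  one_mem_box (by positivity)

theorem neg_mem_leverrierBox {r : ℚ} (hr : r ∈ leverrierBox n D H m) :
    -r ∈ leverrierBox n D H m := neg_mem_box hr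

theorem box_subset_leverrierBox_one : box D H ⊆ leverrierBox n D H 1 :=
  box_subset_box (by simp) (by nlinarith [Nat.zero_le (n * H), Nat.zero_le (n ^ 2 * H)])

theorem sum_mul_mem_box (hB : ∀ i j, B i j ∈ box D H) (hN : ∀ i j, N i j ∈ leverrierBox n D H m)
    (i j : Fin n) (T : Finset (Fin n)) :
    ∑ l ∈ T, B i l * N l j ∈
      box (D ^ (m + 1) * m !) (n * (H * (2 * (n + 1) ^ 2 * H) ^ m)) := by
  simpa [pow_succ', mul_assoc] using sum_mem_box (fun l => mul_mem_box (hB i l) (hN l j)) T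

theorem sum_diag_mul_mem_box (hB : ∀ i j, B i j ∈ box D H)
    (hN : ∀ i j, N i j ∈ leverrierBox n D H m) (T : Finset (Fin n)) :
    ∑ i ∈ T, (B * N) i i ∈
      box (D ^ (m + 1) * m !) (n * (n * (H * (2 * (n + 1) ^ 2 * H) ^ m))) := by
  simpa [Matrix.mul_apply] using sum_mem_box (fun i => sum_mul_mem_box hB hN i i Finset.univ) T

theorem box_subset_leverrierBox_succ {E c : ℕ} (hE : E ∣ D ^ (m + 1) * (m + 1)!)
    (hc : c ≤ 2 * (n + 1) ^ 2) :
    box E (c * (H * (2 * (n + 1) ^ 2 * H) ^ m)) ⊆ leverrierBox n D H (m + 1) := by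
  refine box_subset_box hE ?_
  rw [pow_succ' (2 * _ * H), mul_assoc _ H]
  exact Nat.mul_le_mul_right _ hc

theorem pow_succ_mul_factorial_dvd : D ^ (m + 1) * m ! ∣ D ^ (m + 1) * (m + 1)! :=
  mul_dvd_mul_left _ (Nat.factorial_dvd_factorial m.le_succ)

theorem sum_mul_mem_leverrierBox_succ (hB : ∀ i j, B i j ∈ box D H)
    (hN : ∀ i j, N i j ∈ leverrierBox n D H m) (i j : Fin n) (T : Finset (Fin n)) :
    ∑ l ∈ T, B i l * N l j ∈ leverrierBox n D H (m + 1) :=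
  box_subset_leverrierBox_succ pow_succ_mul_factorial_dvd (by nlinarith)
    (sum_mul_mem_box hB hN i j T)

theorem sum_diag_mul_mem_leverrierBox_succ (hB : ∀ i j, B i j ∈ box D H)
    (hN : ∀ i j, N i j ∈ leverrierBox n D H m) (T : Finset (Fin n)) :
    ∑ i ∈ T, (B * N) i i ∈ leverrierBox n D H (m + 1) := by
  refine box_subset_leverrierBox_succ (c := n * n) pow_succ_mul_factorial_dvd (by nlinarith) ?_
  rw [mul_assoc]
  exact sum_diag_mul_mem_box hB hN T

theorem leverrierScalar_succ_mem_box (hB : ∀ i j, B i j ∈ box D H)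
    (hN : ∀ i j, leverrierMatrix B m i j ∈ leverrierBox n D H m) :
    leverrierScalar B (m + 1) ∈
      box (D ^ (m + 1) * (m + 1)!) (n * (n * (H * (2 * (n + 1) ^ 2 * H) ^ m))) := by
  rw [leverrierScalar_succ, Nat.factorial_succ, mul_comm (m + 1), ← mul_assoc]
  exact div_natCast_mem_box (neg_mem_box (sum_diag_mul_mem_box hB hN Finset.univ)) m.succ_ne_zero

theorem leverrierMatrix_mem_leverrierBox (hB : ∀ i j, B i j ∈ box D H) (m : ℕ) (i j : Fin n) :
    leverrierMatrix B m i j ∈ leverrierBox n D H m := by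
  induction m generalizing i j with
  | zero =>
    rw [leverrierMatrix_zero, Matrix.one_apply]
    split_ifs
    · exact one_mem_box (by simp)
    · exact zero_mem_box
  | succ m ih =>
    have hdiag : Matrix.scalar (Fin n) (leverrierScalar B (m + 1)) i j ∈
        box (D ^ (m + 1) * (m + 1)!) (n * (n * (H * (2 * (n + 1) ^ 2 * H) ^ m))) := by
      rw [Matrix.scalar_apply, Matrix.diagonal_apply]
      split_ifs
      · exact leverrierScalar_succ_mem_box hB ih
      · exact zero_mem_box
    have hprod : (B * leverrierMatrix B m) i j ∈
        box (D ^ (m + 1) * (m + 1)!) (n * (H * (2 * (n + 1) ^ 2 * H) ^ m)) :=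
      box_subset_box pow_succ_mul_factorial_dvd le_rfl (sum_mul_mem_box hB ih i j Finset.univ)
    rw [leverrierMatrix_succ, Matrix.add_apply]
    refine box_subset_leverrierBox_succ (c := n + n * n) dvd_rfl (by nlinarith) ?_
    rw [add_mul, mul_assoc n n]
    exact add_mem_box hprod hdiag

theorem leverrierScalar_mem_leverrierBox (hB : ∀ i j, B i j ∈ box D H) (m : ℕ) :
    leverrierScalar B m ∈ leverrierBox n D H m := by
  cases m with
  | zero =>
    rw [leverrierScalar_zero]
    exact one_mem_box (by simp)
  | succ m =>
    refine box_subset_leverrierBox_succ (c := n * n) dvd_rfl (by nlinarith) ?_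
    rw [mul_assoc]
    exact leverrierScalar_succ_mem_box hB (leverrierMatrix_mem_leverrierBox hB m)

variable (hH : 0 < H) (hB : ∀ i j, B i j ∈ box D H)
include hH hB

theorem numbersIn_leverrier (m : ℕ) : (leverrier B m).NumbersIn (leverrierBox n D H m) := by
  induction m with
  | zero =>
    simpa [leverrier, Instr.NumbersIn, one_mem_leverrierBox hH] using
      numbersIn_identityProg zero_mem_leverrierBox (one_mem_leverrierBox hH)
  | succ m ih =>
    have hN := leverrierMatrix_mem_leverrierBox hB m
    have hmono := leverrierBox_mono (n := n) (D := D) hH m.le_succ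
    have hentry := sum_mul_mem_leverrierBox_succ hB hN
    have htrace := sum_diag_mul_mem_leverrierBox_succ hB hN
    have hmul := numbersIn_mulProg B (leverrierMatrix B m)
      (fun i j => leverrierBox_mono hH (Nat.succ_pos m) (box_subset_leverrierBox_one (hB i j)))
      (fun i j => hmono (hN i j)) hentry
    exact numbersIn_leverrier_succ B m zero_mem_leverrierBox (natCast_mem_leverrierBox hH le_rfl)
      (ih.mono hmono) hmul (fun i j => hentry i j Finset.univ) htrace
      (neg_mem_leverrierBox (htrace Finset.univ)) (leverrierScalar_mem_leverrierBox hB (m + 1))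

theorem numbersIn_detProg : (detProg B).NumbersIn (leverrierBox n D H n) := by
  have hc := leverrierScalar_mem_leverrierBox hB n
  simp only [detProg, bind_eq, pure_eq, numbersIn_bind, numbersIn_instr, run_leverrier]
  refine ⟨trivial, numbersIn_leverrier hH hB n, ?_⟩
  split_ifs
  · trivial
  · simp [Instr.NumbersIn, Instr.eval, zero_mem_leverrierBox, hc]

theorem leverrierMatrix_pred_mem_leverrierBox (i j : Fin n) :
    leverrierMatrix B (n - 1) i j ∈ leverrierBox n D H n :=
  leverrierBox_mono hH (Nat.sub_le n 1) (leverrierMatrix_mem_leverrierBox hB (n - 1) i j)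

theorem numbersIn_invColProg (i : Fin n) :
    (invColProg B i).NumbersIn (leverrierBox n D H n) := by
  have hc := leverrierScalar_mem_leverrierBox hB n
  have hprev := (numbersIn_leverrier hH hB (n - 1)).mono (leverrierBox_mono hH (Nat.sub_le n 1))
  simp [invColProg, run_leverrier, Instr.NumbersIn, Instr.eval, hprev, numbersIn_leverrier hH hB n,
    zero_mem_leverrierBox, hc, neg_mem_leverrierBox hc,
    leverrierMatrix_pred_mem_leverrierBox hH hB]

theorem exists_run_invColProg_eq_div (i : Fin n) :
    ∃ (u : Fin n → ℚ) (d : ℚ), (∀ j, u j ∈ leverrierBox n D H n) ∧ d ∈ leverrierBox n D H n ∧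
      (invColProg B i).run = fun j => u j / d :=
  ⟨fun j => leverrierMatrix B (n - 1) j i, -leverrierScalar B n,
    fun j => leverrierMatrix_pred_mem_leverrierBox hH hB j i,
    neg_mem_leverrierBox (leverrierScalar_mem_leverrierBox hB n),
    by simp [invColProg, run_leverrier, Instr.eval]⟩

end LeverrierBox

section Growth

variable {ι : Type*} {s t : ℕ} {x : ι → ℚ}

/-- The entries of `x` have a common denominator of at most `2 ^ s` and absolute values of at most
`2 ^ s`. -/
def VecBound (s : ℕ) (x : ι → ℚ) : Prop :=
  ∃ E : ℕ, 0 < E ∧ E ≤ 2 ^ s ∧ ∀ j, x j ∈ box E (2 ^ s)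

theorem VecBound.mono (h : VecBound s x) (hst : s ≤ t) : VecBound t x := by
  obtain ⟨E, hE0, hE, hx⟩ := h
  have hpow : 2 ^ s ≤ 2 ^ t := Nat.pow_le_pow_right two_pos hst
  exact ⟨E, hE0, hE.trans hpow, fun j => box_subset_box dvd_rfl hpow (hx j)⟩

theorem VecBound.bitLength_le (h : VecBound s x) (j : ι) : bitLength (x j) ≤ 3 * s + 3 := by
  obtain ⟨E, hE0, hE, hx⟩ := h
  have := bitLength_le_of_mem_box (hx j) hE0.ne' hE le_rfl
  lia

theorem exists_forall_div_mem_box {E G : ℕ} (hE : E ≠ 0) {u : ι → ℚ} (hu : ∀ j, u j ∈ box E G)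
    {i : ι} (hi : u i ≠ 0) :
    ∃ b : ℕ, 0 < b ∧ b ≤ E * G ∧ ∀ j, u j / u i ∈ box b (E * G) := by
  have hE' : (E : ℚ) ≠ 0 := Nat.cast_ne_zero.mpr hE
  obtain ⟨b, hb, hbE⟩ := exists_int_of_mem_box (hu i)
  have hb0 : b ≠ 0 := by
    rintro rfl
    simp [hi, hE'] at hb
  refine ⟨b.natAbs, Int.natAbs_pos.mpr hb0, hbE, fun j => ?_⟩
  obtain ⟨a, ha, haE⟩ := exists_int_of_mem_box (hu j)
  have hab : u j / u i = a / b := by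
    rw [← ha, ← hb, mul_div_mul_right _ _ hE']
  refine ⟨?_, ?_⟩
  · rw [hab, ← Rat.divInt_eq_div]
    simpa using Int.natAbs_dvd_natAbs.mpr (Rat.den_dvd a b)
  · have hb1 : (1 : ℚ) ≤ |(b : ℚ)| := by exact_mod_cast Int.one_le_abs hb0
    calc |u j / u i| = |(a : ℚ)| / |(b : ℚ)| := by rw [hab, abs_div]
      _ ≤ |(a : ℚ)| := div_le_self (abs_nonneg _) hb1
      _ = a.natAbs := by rw [← Int.cast_abs, ← Nat.cast_natAbs]
      _ ≤ (E * G : ℕ) := by exact_mod_cast haE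

-- The denominator `d` cancels, so only the ratios `u j / u i` contribute to the growth.
theorem VecBound.sub_div_mul {E G e : ℕ} (hE : E ≠ 0) (hEG : E * G ≤ 2 ^ e) (h : VecBound s x)
    {u : ι → ℚ} (hu : ∀ j, u j ∈ box E G) {d : ℚ} {i : ι} (hi : u i / d ≠ 0) :
    VecBound (s + e + 1) fun j => x j - x i / (u i / d) * (u j / d) := by
  obtain ⟨hui, hd⟩ := div_ne_zero_iff.mp hi
  obtain ⟨F, hF0, hF, hx⟩ := h
  obtain ⟨b, hb0, hb, hratio⟩ := exists_forall_div_mem_box hE hu hui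
  refine ⟨F * b, Nat.mul_pos hF0 hb0, ?_, fun j => ?_⟩
  · calc F * b ≤ 2 ^ s * 2 ^ e := Nat.mul_le_mul hF (hb.trans hEG)
      _ = 2 ^ (s + e) := (pow_add _ _ _).symm
      _ ≤ 2 ^ (s + e + 1) := Nat.pow_le_pow_right two_pos (Nat.le_succ _)
  · have hcancel : x j - x i / (u i / d) * (u j / d) = x j + -(x i * (u j / u i)) := by
      field_simp
      ring
    have hgrow : 2 ^ s + 2 ^ s * (E * G) ≤ 2 ^ (s + e + 1) := by
      calc 2 ^ s + 2 ^ s * (E * G) ≤ 2 ^ s * 2 ^ e + 2 ^ s * 2 ^ e :=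
            add_le_add (Nat.le_mul_of_pos_right _ (Nat.two_pow_pos e)) (Nat.mul_le_mul_left _ hEG)
        _ = 2 ^ (s + e + 1) := by ring
    beta_reduce
    rw [hcancel]
    exact box_subset_box dvd_rfl hgrow (add_mem_box
      (box_subset_box (dvd_mul_right _ _) le_rfl (hx j))
      (neg_mem_box (mul_mem_box (hx i) (hratio j))))

end Growth

section Numbers

variable {K : Type} [Field K] [LinearOrder K] {n : ℕ} {s : Set K}

theorem numbersIn_padProg (M : Matrix (Fin n) (Fin n) K) (α : Finset (Fin n)) (h0 : 0 ∈ s)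
    (h1 : 1 ∈ s) : (padProg M α).NumbersIn s := by
  simp only [padProg, numbersIn_tabulate]
  intro i j
  split_ifs <;> simp [Instr.NumbersIn, h0, h1]

theorem exists_of_run_minRatioProg_eq_some {k : ℕ} {x b : Fin k → K} {r : K}
    (h : (minRatioProg k x b).run = some r) : ∃ j, 0 < b j ∧ x j / b j = r := by
  have hleast := run_minRatioProg k x b
  rw [h] at hleast
  simpa [positiveRatios] using hleast.1

theorem numbersIn_minRatioProg {k : ℕ} {x b : Fin k → K} (h0 : 0 ∈ s) (hx : ∀ j, x j ∈ s)
    (hb : ∀ j, b j ∈ s) (hxb : ∀ j, x j / b j ∈ s) : (minRatioProg k x b).NumbersIn s := by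
  induction k with
  | zero => trivial
  | succ k ih =>
    have htail := ih (fun j => hx j.succ) (fun j => hb j.succ) fun j => hxb j.succ
    simp only [minRatioProg, bind_eq, pure_eq, numbersIn_bind, numbersIn_instr]
    refine ⟨trivial, htail, by simpa [Instr.NumbersIn] using h0,
      ⟨hb 0, by simpa [Instr.eval] using h0⟩, ?_⟩
    split_ifs
    · trivial
    simp only [numbersIn_bind, numbersIn_instr]
    refine ⟨⟨hx 0, hb 0⟩, ?_⟩
    cases hm : (minRatioProg k (fun j => x j.succ) fun j => b j.succ).run with
    | none => trivial
    | some r =>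
      obtain ⟨j, -, rfl⟩ := exists_of_run_minRatioProg_eq_some hm
      simp only [numbersIn_bind, numbersIn_instr]
      refine ⟨⟨hxb 0, hxb j.succ⟩, ?_⟩
      split_ifs <;> trivial

theorem numbersIn_stepSizeProg {x b : Fin n → K} (h0 : 0 ∈ s) (hx : ∀ j, x j ∈ s)
    (hb : ∀ j, b j ∈ s) (hxb : ∀ j, x j / b j ∈ s) : (stepSizeProg x b).NumbersIn s := by
  cases hm : (minRatioProg n x b).run <;>
    simp [stepSizeProg, hm, numbersIn_minRatioProg h0 hx hb hxb, Instr.NumbersIn, h0]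

theorem run_stepSizeProg_eq_zero_or_div (x b : Fin n → K) :
    (stepSizeProg x b).run = 0 ∨ ∃ j, 0 < b j ∧ x j / b j = (stepSizeProg x b).run := by
  rw [run_stepSizeProg]
  cases hm : (minRatioProg n x b).run with
  | none => exact Or.inl rfl
  | some r => exact Or.inr (exists_of_run_minRatioProg_eq_some hm)

theorem numbersIn_updateProg {x b : Fin n → K} {θ : K} (hx : ∀ j, x j ∈ s) (hb : ∀ j, b j ∈ s)
    (hθ : θ ∈ s) (hθb : ∀ j, θ * b j ∈ s) : (updateProg x b θ).NumbersIn s := by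
  simp [updateProg, Instr.NumbersIn, Instr.eval, hx, hb, hθ, hθb]

theorem numbersIn_nonzeroProg {y : Fin n → K} (h0 : 0 ∈ s) (hy : ∀ j, y j ∈ s) :
    (nonzeroProg y).NumbersIn s := by
  simp only [nonzeroProg, bind_eq, pure_eq, numbersIn_bind, numbersIn_ret, and_true]
  refine numbersIn_firstSome n _ fun j => ?_
  simp only [numbersIn_bind, numbersIn_instr, run_instr, Instr.eval, Instr.NumbersIn,
    Nat.cast_zero]
  refine ⟨h0, ⟨hy j, h0⟩, ⟨h0, hy j⟩, ?_⟩
  split_ifs <;> trivial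

theorem numbersIn_psuppProg {y : Fin n → K} (h0 : 0 ∈ s) (hy : ∀ j, y j ∈ s) :
    (psuppProg y).NumbersIn s := by
  simp [psuppProg, Instr.NumbersIn, Instr.eval, h0, hy]

theorem numbersIn_scanProg : (scanProg n : Prog K Unit).NumbersIn s := by
  simp [scanProg]

end Numbers

section RecursionNumbers

open scoped Nat

variable {n D H a v e s : ℕ} {M : Matrix (Fin n) (Fin n) ℚ} {α : Finset (Fin n)} {x : Fin n → ℚ}

theorem padded_mem_box (hH : 0 < H) (hM : ∀ i j, M i j ∈ box D H) (α : Finset (Fin n))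
    (i j : Fin n) : padded M α i j ∈ box D H := by
  rw [padded]
  split_ifs
  exacts [hM i j, one_mem_box hH, zero_mem_box]

theorem det_mem_leverrierBox {B : Matrix (Fin n) (Fin n) ℚ} (hB : ∀ i j, B i j ∈ box D H) :
    B.det ∈ leverrierBox n D H n := by
  have hc := leverrierScalar_mem_leverrierBox hB n
  rw [Matrix.det_eq_sign_charpoly_coeff, Fintype.card_fin, ← leverrierScalar_self]
  rcases neg_one_pow_eq_or ℚ n with hsign | hsign
  · rwa [hsign, one_mul]
  · rw [hsign, neg_one_mul]
    exact neg_mem_leverrierBox hc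

theorem numbersIn_minorNonposProg (hH : 0 < H) (hM : ∀ i j, M i j ∈ box D H)
    (α : Finset (Fin n)) : (minorNonposProg M α).NumbersIn (leverrierBox n D H n) := by
  have hpad := padded_mem_box hH hM α
  simp [minorNonposProg, run_padProg, run_detProg, Instr.NumbersIn, Instr.eval,
    numbersIn_padProg M α zero_mem_leverrierBox (one_mem_leverrierBox hH),
    numbersIn_detProg hH hpad, zero_mem_leverrierBox, det_mem_leverrierBox hpad]

theorem numbersIn_minorSearchProg (hH : 0 < H) (hM : ∀ i j, M i j ∈ box D H)
    (α : Finset (Fin n)) : (minorSearchProg M α).NumbersIn (leverrierBox n D H n) := by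
  refine numbersIn_firstSome n _ fun i => ?_
  split_ifs
  · simp only [bind_eq, pure_eq, numbersIn_bind]
    refine ⟨numbersIn_scanProg, numbersIn_minorNonposProg hH hM _, ?_⟩
    split_ifs <;> trivial
  · trivial

/-- A bound for the bit lengths of all numbers of a run in which the numbers of the
Faddeev–LeVerrier method have at most `a` bits and the entries of the vectors at most `v` bits: an
entry of a column of the inverse is a quotient of two numbers of the former kind, so it has at most
`4 * a` bits, a ratio then has at most `2 * (v + 4 * a)` bits, and a product of the two at most
the given number. The semiring is arbitrary so that the bound can be formed for polynomials. -/
def numberBound {R : Type*} [Semiring R] (a v : R) : R :=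
  2 * (2 * (v + 4 * a) + 4 * a)

theorem subset_numberBound_of_subset {T : Set ℚ} (hT : T ⊆ {r | bitLength r ≤ a}) :
    T ⊆ {r | bitLength r ≤ numberBound a v} := by
  have hle : a ≤ numberBound a v := by
    rw [numberBound]
    lia
  exact fun r hr => le_trans (hT hr) hle

theorem numbersIn_updateProg_stepSizeProg {b : Fin n → ℚ} (hx : ∀ j, bitLength (x j) ≤ v)
    (hb : ∀ j, bitLength (b j) ≤ 4 * a) (h0 : bitLength 0 ≤ a) :
    ((stepSizeProg x b).bind fun θ => updateProg x b θ).NumbersIn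
      {r | bitLength r ≤ numberBound a v} := by
  have hratio (j : Fin n) : bitLength (x j / b j) ≤ 2 * (v + 4 * a) := by
    have := bitLength_div_le (x j) (b j)
    have := hx j
    have := hb j
    lia
  have hθ : bitLength (stepSizeProg x b).run ≤ 2 * (v + 4 * a) := by
    rcases run_stepSizeProg_eq_zero_or_div x b with h | ⟨j, -, h⟩
    · rw [h]
      lia
    · exact h ▸ hratio j
  have hx' (j : Fin n) : bitLength (x j) ≤ numberBound a v :=
    (hx j).trans (by rw [numberBound]; lia)
  have hb' (j : Fin n) : bitLength (b j) ≤ numberBound a v :=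
    (hb j).trans (by rw [numberBound]; lia)
  have hθb (j : Fin n) : bitLength ((stepSizeProg x b).run * b j) ≤ numberBound a v := by
    have := bitLength_mul_le (stepSizeProg x b).run (b j)
    have := hb j
    rw [numberBound]
    lia
  rw [numbersIn_bind]
  refine ⟨numbersIn_stepSizeProg ?_ hx' hb' fun j => (hratio j).trans ?_,
    numbersIn_updateProg hx' hb' (hθ.trans ?_) hθb⟩
  · exact h0.trans (by rw [numberBound]; lia)
  all_goals
    rw [numberBound]
    lia

section Reduction

variable (hH : 0 < H) (hM : ∀ i j, M i j ∈ box D H)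
include hH hM

theorem numbersIn_reduceProg (ha : leverrierBox n D H n ⊆ {r | bitLength r ≤ a})
    (hx : ∀ j, bitLength (x j) ≤ v) (α : Finset (Fin n)) (i : Fin n) :
    (reduceProg M α x i).NumbersIn {r | bitLength r ≤ numberBound a v} := by
  have hpad := padded_mem_box hH hM α
  obtain ⟨u, d, hu, hd, hcol⟩ := exists_run_invColProg_eq_div hH hpad i
  have hsub := subset_numberBound_of_subset (v := v) ha
  have hb (j : Fin n) : bitLength (u j / d) ≤ 4 * a := by
    have := bitLength_div_le (u j) d
    have huj : bitLength (u j) ≤ a := ha (hu j)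
    have hda : bitLength d ≤ a := ha hd
    lia
  rw [reduceProg_eq, numbersIn_bind, run_padProg, numbersIn_bind, hcol]
  exact ⟨(numbersIn_padProg M α zero_mem_leverrierBox (one_mem_leverrierBox hH)).mono hsub,
    (numbersIn_invColProg hH hpad i).mono hsub,
    numbersIn_updateProg_stepSizeProg hx hb (ha zero_mem_leverrierBox)⟩

variable (hD : 0 < D) (he : D ^ n * n ! * (2 * (n + 1) ^ 2 * H) ^ n ≤ 2 ^ e)
  (hx : VecBound s x)
include hD he hx

theorem vecBound_run_reduceProg (α : Finset (Fin n)) (i : Fin n) :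
    VecBound (s + e + 1) (reduceProg M α x i).run := by
  obtain ⟨u, d, hu, -, hcol⟩ := exists_run_invColProg_eq_div hH (padded_mem_box hH hM α) i
  rw [reduceProg_eq, run_bind, run_padProg, run_bind, hcol, run_bind, run_updateProg]
  rcases run_stepSizeProg_eq_zero_or_div x fun j => u j / d with h | ⟨j, hj, h⟩
  · simpa [h] using hx.mono (by lia)
  · rw [← h]
    exact hx.sub_div_mul (Nat.mul_pos (Nat.pow_pos hD) n.factorial_pos).ne' he hu hj.ne'

theorem vecBound_of_run_reductionSearchProg {y : Fin n → ℚ}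
    (hy : (reductionSearchProg M α x).run = some y) : VecBound (s + e + 1) y := by
  rw [reductionSearchProg, run_firstSome] at hy
  obtain ⟨i, -, hi⟩ := List.exists_of_findSome?_eq_some hy
  have hyi : (reduceProg M α x i).run = y := by
    by_cases hiα : i ∈ α <;> by_cases hnz : (nonzeroProg (reduceProg M α x i).run).run <;>
      simp_all
  exact hyi ▸ vecBound_run_reduceProg hH hM hD he hx α i

theorem numbersIn_reductionSearchProg (ha : leverrierBox n D H n ⊆ {r | bitLength r ≤ a})
    (hv : 3 * (s + e + 1) + 3 ≤ v) (α : Finset (Fin n)) :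
    (reductionSearchProg M α x).NumbersIn {r | bitLength r ≤ numberBound a v} := by
  refine numbersIn_firstSome n _ fun i => ?_
  split_ifs
  · have hxv (j : Fin n) : bitLength (x j) ≤ v := (hx.bitLength_le j).trans (by lia)
    have hyv (j : Fin n) : bitLength ((reduceProg M α x i).run j) ≤ numberBound a v := by
      refine ((vecBound_run_reduceProg hH hM hD he hx α i).bitLength_le j).trans ?_
      rw [numberBound]
      lia
    simp only [bind_eq, pure_eq, numbersIn_bind]
    refine ⟨numbersIn_reduceProg hH hM ha hxv α i,
      numbersIn_nonzeroProg (subset_numberBound_of_subset ha zero_mem_leverrierBox) hyv, ?_⟩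
    split_ifs <;> trivial
  · trivial

omit hx in
theorem numbersIn_recursiveFindProg (ha : leverrierBox n D H n ⊆ {r | bitLength r ≤ a}) (t : ℕ)
    (α : Finset (Fin n)) (hx : VecBound s x) (hv : 3 * (s + t * (e + 1)) + 3 ≤ v) :
    (recursiveFindProg M t α x).NumbersIn {r | bitLength r ≤ numberBound a v} := by
  have hsub := subset_numberBound_of_subset (v := v) ha
  induction t generalizing α x s with
  | zero => trivial
  | succ t ih =>
    rw [recursiveFindProg_succ, numbersIn_bind]
    refine ⟨numbersIn_scanProg, ?_⟩
    split_ifs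
    · trivial
    rw [numbersIn_bind]
    refine ⟨(numbersIn_minorNonposProg hH hM α).mono hsub, ?_⟩
    split_ifs
    · trivial
    rw [numbersIn_bind]
    refine ⟨(numbersIn_minorSearchProg hH hM α).mono hsub, ?_⟩
    cases (minorSearchProg M α).run with
    | some γ => trivial
    | none =>
      have hv' : 3 * (s + e + 1 + t * (e + 1)) + 3 ≤ v := le_trans (le_of_eq (by ring)) hv
      rw [numbersIn_bind]
      refine ⟨numbersIn_reductionSearchProg hH hM hD he hx ha (by lia) α, ?_⟩
      cases hrun : (reductionSearchProg M α x).run with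
      | none => trivial
      | some y =>
        have hy := vecBound_of_run_reductionSearchProg hH hM hD he hx hrun
        have hyv (j : Fin n) : bitLength (y j) ≤ numberBound a v :=
          (hy.bitLength_le j).trans (by rw [numberBound]; lia)
        rw [numbersIn_bind]
        exact ⟨numbersIn_psuppProg (hsub zero_mem_leverrierBox) hyv, ih _ hy hv'⟩

end Reduction

end RecursionNumbers

section Input

open scoped Nat

theorem den_le_two_pow_bitLength (r : ℚ) : r.den ≤ 2 ^ bitLength r :=
  r.den.lt_size_self.le.trans (Nat.pow_le_pow_right two_pos (by rw [bitLength]; lia))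

theorem vecBound_sum_bitLength {ι : Type*} [Fintype ι] (x : ι → ℚ) :
    VecBound (∑ i, bitLength (x i)) x := by
  refine ⟨∏ i, (x i).den, Finset.prod_pos fun i _ => (x i).den_pos, ?_, fun i => ?_⟩
  · rw [← Finset.prod_pow_eq_pow_sum]
    exact Finset.prod_le_prod' fun i _ => den_le_two_pow_bitLength (x i)
  · exact box_subset_box (Finset.dvd_prod_of_mem (fun i => (x i).den) (Finset.mem_univ i))
      (Nat.pow_le_pow_right two_pos (Finset.single_le_sum (f := fun i => bitLength (x i))
        (fun _ _ => Nat.zero_le _) (Finset.mem_univ i))) (mem_box_den (x i))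

variable {n : ℕ}

section InputLength

variable (M : Matrix (Fin n) (Fin n) ℚ) (x : Fin n → ℚ)

theorem le_inputLength : n ≤ inputLength M x := by
  have h : ∑ _i : Fin n, 1 ≤ ∑ i, bitLength (x i) :=
    Finset.sum_le_sum fun i _ => Nat.le_add_left 1 _
  rw [Finset.sum_const, Finset.card_univ, Fintype.card_fin, smul_eq_mul, mul_one] at h
  exact h.trans (Nat.le_add_left _ _)

theorem vecBound_inputLength : VecBound (inputLength M x) x :=
  (vecBound_sum_bitLength x).mono (Nat.le_add_left _ _)

theorem vecBound_uncurry_inputLength : VecBound (inputLength M x) (Function.uncurry M) := by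
  refine (vecBound_sum_bitLength (Function.uncurry M)).mono ?_
  rw [Fintype.sum_prod_type]
  exact Nat.le_add_right _ _

end InputLength

section Bounds

variable {D L : ℕ} (hn : n ≤ L)
include hn

theorem pow_mul_factorial_le_two_pow (hD : D ≤ 2 ^ L) : D ^ n * n ! ≤ 2 ^ (2 * L ^ 2) := by
  have hpow : D ^ n ≤ (2 ^ L) ^ L :=
    (Nat.pow_le_pow_left hD n).trans (Nat.pow_le_pow_right (Nat.two_pow_pos L) hn)
  have hfactorial : n ! ≤ (2 ^ L) ^ L :=
    n.factorial_le_pow.trans ((Nat.pow_le_pow_left (hn.trans L.lt_two_pow_self.le) n).trans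
      (Nat.pow_le_pow_right (Nat.two_pow_pos L) hn))
  calc D ^ n * n ! ≤ (2 ^ L) ^ L * (2 ^ L) ^ L := Nat.mul_le_mul hpow hfactorial
    _ = 2 ^ (2 * L ^ 2) := by ring

theorem pow_le_two_pow : (2 * (n + 1) ^ 2 * 2 ^ L) ^ n ≤ 2 ^ (3 * L ^ 2 + L) := by
  have hsucc : n + 1 ≤ 2 ^ L := (Nat.succ_le_succ hn).trans L.lt_two_pow_self
  have hbase : 2 * (n + 1) ^ 2 * 2 ^ L ≤ 2 ^ (3 * L + 1) := by
    calc 2 * (n + 1) ^ 2 * 2 ^ L ≤ 2 * (2 ^ L) ^ 2 * 2 ^ L := by gcongr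
      _ = 2 ^ (3 * L + 1) := by ring
  calc (2 * (n + 1) ^ 2 * 2 ^ L) ^ n ≤ (2 ^ (3 * L + 1)) ^ L :=
        (Nat.pow_le_pow_left hbase n).trans (Nat.pow_le_pow_right (Nat.two_pow_pos _) hn)
    _ = 2 ^ (3 * L ^ 2 + L) := by ring

theorem pow_mul_factorial_mul_pow_le_two_pow (hD : D ≤ 2 ^ L) :
    D ^ n * n ! * (2 * (n + 1) ^ 2 * 2 ^ L) ^ n ≤ 2 ^ (5 * L ^ 2 + L) := by
  calc D ^ n * n ! * (2 * (n + 1) ^ 2 * 2 ^ L) ^ n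
      ≤ 2 ^ (2 * L ^ 2) * 2 ^ (3 * L ^ 2 + L) :=
        Nat.mul_le_mul (pow_mul_factorial_le_two_pow hn hD) (pow_le_two_pow hn)
    _ = 2 ^ (5 * L ^ 2 + L) := by ring

theorem leverrierBox_subset_bitLength_le (hD0 : 0 < D) (hD : D ≤ 2 ^ L) :
    leverrierBox n D (2 ^ L) n ⊆ {r | bitLength r ≤ 7 * L ^ 2 + L + 3} := fun r hr => by
  have hlength := bitLength_le_of_mem_box hr (Nat.mul_pos (Nat.pow_pos hD0) n.factorial_pos).ne'
    (pow_mul_factorial_le_two_pow hn hD) (pow_le_two_pow hn)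
  exact hlength.trans (by lia)

end Bounds

/-- A bound for the bit lengths of all numbers of a run on an input of bit length `L`: in at most
`L` calls the bit length of a common denominator of the vector grows by `5 * L ^ 2 + L + 1` each
time. The semiring is arbitrary so that the bound can be formed for polynomials. -/
def numberLength {R : Type*} [Semiring R] (L : R) : R :=
  numberBound (7 * L ^ 2 + L + 3) (3 * (L + L * (5 * L ^ 2 + L + 1)) + 3)

theorem eval_numberLength (L : ℕ) :
    (numberLength Polynomial.X : Polynomial ℕ).eval L = numberLength L := by
  simp [numberLength, numberBound]

variable (M : Matrix (Fin n) (Fin n) ℚ) (x : Fin n → ℚ)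

theorem numbersIn_findNonpositiveMinorProg :
    (findNonpositiveMinorProg M x).NumbersIn
      {r | bitLength r ≤ numberLength (inputLength M x)} := by
  obtain ⟨D, hD0, hD, hM⟩ := vecBound_uncurry_inputLength M x
  have hn := le_inputLength M x
  have hx := vecBound_inputLength M x
  generalize inputLength M x = L at *
  exact numbersIn_recursiveFindProg (Nat.two_pow_pos L) (fun i j => hM (i, j)) hD0
    (pow_mul_factorial_mul_pow_le_two_pow hn hD) (leverrierBox_subset_bitLength_le hn hD0 hD) n
    Finset.univ hx (by gcongr)

theorem bitTime_findNonpositiveMinorProg_le :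
    (findNonpositiveMinorProg M x).bitTime ≤ totalSteps (inputLength M x) *
      ((numberLength (inputLength M x) + numberLength (inputLength M x)) ^ 2 + 1) :=
  (bitTime_le _ (numbersIn_findNonpositiveMinorProg M x)).trans (Nat.mul_le_mul_right _
    ((steps_recursiveFindProg_le M n Finset.univ x).trans (totalSteps_mono (le_inputLength M x))))

theorem exists_polynomial_steps_le : ∃ p : Polynomial ℕ, ∀ (K : Type) [Field K] [LinearOrder K]
    (n : ℕ) (M : Matrix (Fin n) (Fin n) K) (x : Fin n → K),
    (findNonpositiveMinorProg M x).steps ≤ p.eval n :=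
  ⟨totalSteps Polynomial.X, fun _ _ _ n M x => by
    rw [eval_totalSteps]
    exact steps_recursiveFindProg_le M n Finset.univ x⟩

theorem exists_polynomial_bitTime_le : ∃ p : Polynomial ℕ, ∀ (n : ℕ)
    (M : Matrix (Fin n) (Fin n) ℚ) (x : Fin n → ℚ),
    (findNonpositiveMinorProg M x).bitTime ≤ p.eval (inputLength M x) :=
  ⟨totalSteps Polynomial.X * ((numberLength Polynomial.X + numberLength Polynomial.X) ^ 2 + 1),
    fun _ M x => by
      simpa [eval_totalSteps, eval_numberLength] using bitTime_findNonpositiveMinorProg_le M x⟩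

end Input

end NonposMinor

theorem mainTheorem2_general :
    (∀ (K : Type) [Field K] [LinearOrder K] [IsStrictOrderedRing K] (n : ℕ)
      (M : Matrix (Fin n) (Fin n) K) (x : Fin n → K),
      0 < n → (∀ i, 0 < x i) → (∀ i, M.mulVec x i ≤ 0) →
        (NonposMinor.principal M (NonposMinor.findNonpositiveMinor M x)).det ≤ 0 ∧
        (NonposMinor.findNonpositiveMinorProg M x).run = NonposMinor.findNonpositiveMinor M x ∧
        2 * (NonposMinor.findNonpositiveMinorProg M x).dets ≤ n * (n + 3)) ∧
    (∀ (K : Type) [Field K] [LinearOrder K] [CharZero K] (n : ℕ)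
      (B : Matrix (Fin n) (Fin n) K), (NonposMinor.detProg B).run = B.det) ∧
    (∀ (K : Type) [Field K] [LinearOrder K] [IsStrictOrderedRing K] (n : ℕ)
      (M : Matrix (Fin n) (Fin n) K) (α : Finset (Fin n)) (x : Fin n → K),
      2 ≤ α.card → (∀ i ∈ α, 0 < x i) → (∀ i ∉ α, x i = 0) → (∀ i ∈ α, M.mulVec x i ≤ 0) →
      0 < (NonposMinor.principal M α).det →
      (∀ i ∈ α, 0 < (NonposMinor.principal M (α.erase i)).det) →
        (∀ i ∈ α, (∀ j, 0 ≤ NonposMinor.reduceOn M α x i j) ∧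
          (∀ j ∈ α, M.mulVec (NonposMinor.reduceOn M α x i) j ≤ 0) ∧
          NonposMinor.psupp (NonposMinor.reduceOn M α x i) ⊂ α) ∧
        ∃ i ∈ α, NonposMinor.reduceOn M α x i ≠ 0) ∧
    (∃ p : Polynomial ℕ, ∀ (K : Type) [Field K] [LinearOrder K] (n : ℕ)
      (M : Matrix (Fin n) (Fin n) K) (x : Fin n → K),
        (NonposMinor.findNonpositiveMinorProg M x).steps ≤ p.eval n) ∧
    (∃ p : Polynomial ℕ, ∀ (n : ℕ) (M : Matrix (Fin n) (Fin n) ℚ) (x : Fin n → ℚ),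
        (NonposMinor.findNonpositiveMinorProg M x).bitTime ≤
          p.eval (NonposMinor.inputLength M x)) := by
  refine ⟨?_, ?_, ?_, NonposMinor.exists_polynomial_steps_le,
    NonposMinor.exists_polynomial_bitTime_le⟩
  · intro K _ _ _ n M x hn hx hM
    have hadm : NonposMinor.Admissible M Finset.univ x :=
      ⟨fun i _ => hx i, fun i hi => absurd (Finset.mem_univ i) hi, fun i _ => hM i⟩
    have hne : (Finset.univ : Finset (Fin n)).Nonempty := ⟨⟨0, hn⟩, Finset.mem_univ _⟩
    have hcard : (Finset.univ : Finset (Fin n)).card = n := Finset.card_fin n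
    have hdets := NonposMinor.two_mul_dets_recursiveFindProg_le hadm hne hcard.le
    rw [hcard] at hdets
    exact ⟨NonposMinor.det_principal_recursiveFind_nonpos hadm hne hcard.le,
      NonposMinor.run_recursiveFindProg hadm hne hcard.le, hdets⟩
  · intro K _ _ _ n B
    exact NonposMinor.run_detProg B
  · intro K _ _ _ n M α x hcard hpos hzero hnonpos hdet hminors
    have hadm : NonposMinor.Admissible M α x := ⟨hpos, hzero, hnonpos⟩
    exact ⟨fun i hi => ⟨hadm.reduceOn_nonneg hdet.ne' hi,
      fun j hj => hadm.mulVec_reduceOn_nonpos hdet.ne' hi hj,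
      hadm.psupp_reduceOn_ssubset hdet hi (hminors i hi)⟩,
      hadm.exists_reduceOn_ne_zero hcard hdet.ne'⟩

theorem mainTheorem2 :
    -- correctness and number of determinants
    (∀ (K : Type) [Field K] [LinearOrder K] [IsStrictOrderedRing K] (n : ℕ)
      (M : Matrix (Fin n) (Fin n) K) (x : Fin n → K),
      0 < n → (∀ i, 0 < x i) → (∀ i, M.mulVec x i ≤ 0) →
        (NonposMinor.principal M (NonposMinor.findNonpositiveMinor M x)).det ≤ 0 ∧
        (NonposMinor.findNonpositiveMinorProg M x).run = NonposMinor.findNonpositiveMinor M x ∧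
        2 * (NonposMinor.findNonpositiveMinorProg M x).dets ≤ n * (n + 3)) ∧
    -- the routine whose calls are counted returns the determinant
    (∀ (K : Type) [Field K] [LinearOrder K] [IsStrictOrderedRing K] (n : ℕ)
      (B : Matrix (Fin n) (Fin n) K), (NonposMinor.detProg B).run = B.det) ∧
    -- the reduction step in a recursive call
    (∀ (K : Type) [Field K] [LinearOrder K] [IsStrictOrderedRing K] (n : ℕ)
      (M : Matrix (Fin n) (Fin n) K) (α : Finset (Fin n)) (x : Fin n → K),
      2 ≤ α.card → (∀ i ∈ α, 0 < x i) → (∀ i ∉ α, x i = 0) → (∀ i ∈ α, M.mulVec x i ≤ 0) →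
      0 < (NonposMinor.principal M α).det →
      (∀ i ∈ α, 0 < (NonposMinor.principal M (α.erase i)).det) →
        (∀ i ∈ α, (∀ j, 0 ≤ NonposMinor.reduceOn M α x i j) ∧
          (∀ j ∈ α, M.mulVec (NonposMinor.reduceOn M α x i) j ≤ 0) ∧
          NonposMinor.psupp (NonposMinor.reduceOn M α x i) ⊂ α) ∧
        ∃ i ∈ α, NonposMinor.reduceOn M α x i ≠ 0) ∧
    -- polynomially many arithmetic operations, comparisons and bookkeeping steps
    (∃ p : Polynomial ℕ, ∀ (K : Type) [Field K] [LinearOrder K] [IsStrictOrderedRing K] (n : ℕ)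
      (M : Matrix (Fin n) (Fin n) K) (x : Fin n → K),
      0 < n → (∀ i, 0 < x i) → (∀ i, M.mulVec x i ≤ 0) →
        (NonposMinor.findNonpositiveMinorProg M x).steps ≤ p.eval n) ∧
    -- polynomial bit complexity on rational data
    (∃ p : Polynomial ℕ, ∀ (n : ℕ) (M : Matrix (Fin n) (Fin n) ℚ) (x : Fin n → ℚ),
      0 < n → (∀ i, 0 < x i) → (∀ i, M.mulVec x i ≤ 0) →
        (NonposMinor.findNonpositiveMinorProg M x).bitTime ≤
          p.eval (NonposMinor.inputLength M x)) := by
  obtain ⟨hcorrect, hdet, hreduction, ⟨p, hp⟩, ⟨q, hq⟩⟩ := mainTheorem2_general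
  exact ⟨hcorrect, fun K _ _ _ => hdet K, hreduction, ⟨p, fun K _ _ _ n M x _ _ _ => hp K n M x⟩,
    ⟨q, fun n M x _ _ _ => hq n M x⟩⟩
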